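/- Let $\omega_1,\omega_2\in\mathbb C$ with $\operatorname{Im}\omega_1>0$ and $\operatorname{Im}\omega_2>0$. Definitions. For $\omega=(\omega_1,\dots,\omega_r)$ with all $\operatorname{Im}\omega_i>0$, let $\zeta_r(s,z\,|\,\omega)$ be the analytic continuation to $s=0$ of $\sum_{n\in\mathbb Z_{\ge 0}^r}(z+n_1\omega_1+\dots+n_r\omega_r)^{-s}$ ($\operatorname{Re}s>r$, principal powers), let $\Gamma_r(z\,|\,\omega)=\exp\bigl(\partial_s\zeta_r(s,z\,|\,\omega)|_{s=0}\bigr)$ be the multiple gamma function, and let $\sin_r(z\,|\,\omega)=\Gamma_r(z\,|\,\omega)^{-1}\,\Gamma_r(\omega_1+\dots+\omega_r-z\,|\,\omega)^{(-1)^r}$ be the multiple sine function. The multiple Bernoulli polynomials are given by $\dfrac{t^r e^{zt}}{\prod_{i=1}^r(e^{\omega_i t}-1)}=\sum_{n\ge0}B_{r,n}(z\,|\,\omega)\dfrac{t^n}{n!}$. Put $$F_2(z\,|\,\omega_1,\omega_2)=e^{-\frac{\pi i}{2}B_{2,2}(z|\omega_1,\omega_2)}\sin_2(z\,|\,\omega_1,\omega_2),\qquad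 G_3(z\,|\,\omega_1,\omega_2)=e^{\frac{\pi i}{6}B_{3,3}(z+\omega_1|\omega_1,\omega_1,\omega_2)}\sin_3(z+\omega_1\,|\,\omega_1,\omega_1,\omega_2).$$ Let $z\in\mathbb C$ be such that $z+\omega_2$ is neither a zero nor a pole of $F_2(\,\cdot\,|\,\omega_1,2\omega_2)$, i.e. $z+\omega_2\ne a\omega_1+2b\omega_2$ for all integers $a,b$ with $a,b\le0$ or $a,b>0$. Then $F_2(z+\omega_2\,|\,\omega_1,2\omega_2)$, $G_3(z+\omega_2\,|\,\omega_1,2\omega_2)$ and $G_3(z\pm\omega_2\,|\,2\omega_2,\omega_1)$ are non-zero and holomorphic in each of the variables with respect to which they are differentiated below, and $$\frac{\partial}{\partial\omega_2}\log F_2(z+\omega_2\,|\,\omega_1,2\omega_2)=\frac{\partial}{\partial z}\bigl(\log G_3(z+\omega_2\,|\,2\omega_2,\omega_1)+\log G_3(z-\omega_2\,|\,2\omega_2,\omega_1)\bigr),$$ $$\frac{\partial}{\partial\omega_2}\log G_3(z+\omega_2\,|\,\omega_1,2\omega_2)=\frac{\partial}{\partial\omega_1}\bigl(\log G_3(z+\omega_2\,|\,2\omega_2,\omega_1)+\log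 G_3(z-\omega_2\,|\,2\omega_2,\omega_1)\bigr).$$ Here $\partial\log f$ is the logarithmic derivative $\partial f/f$, and each derivative is taken with the remaining ones of $z,\omega_1,\omega_2$ held fixed. -/

import Mathlib

noncomputable section

namespace MultipleSine

/-- The linear form `n · ω = n₁ ω₁ + ⋯ + n_r ω_r`. -/
def dot {r : ℕ} (n : Fin r → ℕ) (ω : Fin r → ℂ) : ℂ := ∑ i, (n i : ℂ) * ω i

/-- The multiple Bernoulli polynomial `B_{r,n}(z | ω)`: `n!` times the coefficient of `t ^ n` in
`t ^ r * exp (z t) / ∏ i, (exp (ω_i t) - 1)`, where each factor `t / (exp (ω_i t) - 1)` is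
expanded as `ω_i⁻¹ * ∑ k, B_k (ω_i t) ^ k / k!` (all `ω_i ≠ 0`). -/
def multipleBernoulli {r : ℕ} (n : ℕ) (ω : Fin r → ℂ) (z : ℂ) : ℂ :=
  (n.factorial : ℂ) * PowerSeries.coeff n
    (PowerSeries.rescale z (PowerSeries.exp ℂ) *
      ∏ i, PowerSeries.C (ω i)⁻¹ * PowerSeries.rescale (ω i) (bernoulliPowerSeries ℂ))

/-- The usual explicit form of `B_{2,2}`. -/
theorem multipleBernoulli_two_two {ω₁ ω₂ : ℂ} (h₁ : ω₁ ≠ 0) (h₂ : ω₂ ≠ 0) (z : ℂ) :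
    multipleBernoulli 2 ![ω₁, ω₂] z =
      z ^ 2 / (ω₁ * ω₂) - (1 / ω₁ + 1 / ω₂) * z + 1 / 6 * (ω₂ / ω₁ + ω₁ / ω₂) + 1 / 2 := by
  simp [multipleBernoulli, Fin.prod_univ_two, PowerSeries.coeff_mul,
    Finset.Nat.antidiagonal_succ, bernoulliPowerSeries,
    PowerSeries.coeff_rescale, PowerSeries.coeff_exp, PowerSeries.coeff_C]
  field_simp
  ring

/-- `Z` is the holomorphic continuation to `{Re s > -1} ∖ {1, …, r}` of the Barnes zeta series
`∑_{n ∈ ℕ^r} (z + n · ω) ^ (-s)`, `Re s > r`. Powers are principal. If all `ω_i` lie in the open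
upper half-plane, all but finitely many `z + n · ω` do so too, where the principal logarithm is
holomorphic. -/
def IsBarnesZeta {r : ℕ} (ω : Fin r → ℂ) (z : ℂ) (Z : ℂ → ℂ) : Prop :=
  DifferentiableOn ℂ Z {s | -1 < s.re ∧ ∀ k ∈ Finset.Icc 1 r, s ≠ (k : ℂ)} ∧
    ∀ s : ℂ, (r : ℝ) < s.re → HasSum (fun n : Fin r → ℕ => (z + dot n ω) ^ (-s)) (Z s)

/-- Two continuations agree near `0`. -/
theorem IsBarnesZeta.eqOn_ball {r : ℕ} {ω : Fin r → ℂ} {z : ℂ} {Z W : ℂ → ℂ}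
    (hZ : IsBarnesZeta ω z Z) (hW : IsBarnesZeta ω z W) : Set.EqOn Z W (Metric.ball 0 1) := by
  set D : Set ℂ := {s | -1 < s.re ∧ ∀ k ∈ Finset.Icc 1 r, s ≠ (k : ℂ)} with hD
  have key : ∀ (S : Set ℂ) (s₀ : ℂ), IsOpen S → Convex ℝ S → S ⊆ D → s₀ ∈ S →
      Z =ᶠ[nhds s₀] W → Set.EqOn Z W S := by
    intro S s₀ hS hc hSD hs₀ h
    exact AnalyticOnNhd.eqOn_of_preconnected_of_eventuallyEq
      ((hZ.1.mono hSD).analyticOnNhd hS) ((hW.1.mono hSD).analyticOnNhd hS)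
      hc.isPreconnected hs₀ h
  have hupper : Set.EqOn Z W {s | -1 < s.re ∧ 0 < s.im} := by
    refine key _ ((r : ℂ) + 1 + Complex.I) ?_ ?_ ?_ ?_ ?_
    · exact (isOpen_lt continuous_const Complex.continuous_re).inter
        (isOpen_lt continuous_const Complex.continuous_im)
    · exact (convex_halfSpace_re_gt _).inter (convex_halfSpace_im_gt _)
    · rintro s ⟨h1, h2⟩
      refine ⟨h1, fun k _ hk => ?_⟩
      simp [hk] at h2
    · simp only [Set.mem_ofPred_eq, Complex.add_re, Complex.add_im, Complex.natCast_re,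
        Complex.natCast_im, Complex.one_re, Complex.one_im, Complex.I_re, Complex.I_im]
      constructor
      · have : (0 : ℝ) ≤ r := Nat.cast_nonneg r
        linarith
      · norm_num
    · have : {s : ℂ | (r : ℝ) < s.re} ∈ nhds ((r : ℂ) + 1 + Complex.I) :=
        (isOpen_lt continuous_const Complex.continuous_re).mem_nhds (by simp)
      filter_upwards [this] with s hs
      exact (hZ.2 s hs).unique (hW.2 s hs)
  refine key _ (Complex.I / 2) Metric.isOpen_ball (convex_ball _ _) ?_ ?_ ?_
  · intro s hs
    rw [mem_ball_zero_iff] at hs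
    refine ⟨?_, fun k hk h => ?_⟩
    · have := Complex.abs_re_le_norm s
      have := neg_abs_le s.re
      linarith
    · rw [h, Complex.norm_natCast] at hs
      have : (1 : ℝ) ≤ k := by exact_mod_cast (Finset.mem_Icc.1 hk).1
      linarith
  · simp; norm_num
  · have : {s : ℂ | -1 < s.re ∧ 0 < s.im} ∈ nhds (Complex.I / 2) :=
      ((isOpen_lt continuous_const Complex.continuous_re).inter
        (isOpen_lt continuous_const Complex.continuous_im)).mem_nhds (by simp)
    filter_upwards [this] with s hs using hupper hs

/-- The Barnes multiple zeta function `ζ_r(s, z | ω)`, continued to `{Re s > -1} ∖ {1, …, r}`. -/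
def barnesZeta {r : ℕ} (ω : Fin r → ℂ) (z : ℂ) : ℂ → ℂ :=
  Classical.epsilon (IsBarnesZeta ω z)

open Classical in
/-- The Barnes multiple gamma function `Γ_r(z | ω) = exp (∂_s ζ_r(s, z | ω) at s = 0)`, for
`ω_i` in the open upper half-plane. Its poles are the points `z = - n · ω`; there the value is `0`
by convention (as for `Complex.Gamma`), so that `(multipleGamma ω z)⁻¹` is the entire
function `1 / Γ_r(z | ω)` at every `z`. (Changing the branch of finitely many of the powers in the
zeta series changes `∂_s ζ_r` at `0` by a multiple of `2 π i`, hence does not change `Γ_r`.) -/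
def multipleGamma {r : ℕ} (ω : Fin r → ℂ) (z : ℂ) : ℂ :=
  if ∃ n : Fin r → ℕ, z + dot n ω = 0 then 0 else Complex.exp (deriv (barnesZeta ω z) 0)

/-- The multiple sine function
`sin_r(z | ω) = Γ_r(z | ω)⁻¹ * Γ_r(ω₁ + ⋯ + ω_r - z | ω) ^ ((-1) ^ r)`. -/
def multipleSine {r : ℕ} (ω : Fin r → ℂ) (z : ℂ) : ℂ :=
  (multipleGamma ω z)⁻¹ * multipleGamma ω (∑ i, ω i - z) ^ ((-1 : ℤ) ^ r)

/-- `F₂(z | ω₁, ω₂) = exp (-(π i / 2) B_{2,2}(z | ω₁, ω₂)) * sin₂(z | ω₁, ω₂)`. -/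
def F₂ (z ω₁ ω₂ : ℂ) : ℂ :=
  Complex.exp (-(Real.pi * Complex.I / 2) * multipleBernoulli 2 ![ω₁, ω₂] z) *
    multipleSine ![ω₁, ω₂] z

/-- `G₃(z | ω₁, ω₂) =
exp ((π i / 6) B_{3,3}(z + ω₁ | ω₁, ω₁, ω₂)) * sin₃(z + ω₁ | ω₁, ω₁, ω₂)`. -/
def G₃ (z ω₁ ω₂ : ℂ) : ℂ :=
  Complex.exp ((Real.pi * Complex.I / 6) * multipleBernoulli 3 ![ω₁, ω₁, ω₂] (z + ω₁)) *
    multipleSine ![ω₁, ω₁, ω₂] (z + ω₁)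

end MultipleSine

end

namespace MultipleSine

open MeasureTheory Set Filter Topology Metric
open scoped Real

/-! ### Holomorphic dependence of integrals on parameters -/

section HolomorphicIntegrals

/-! For z and all ω_j in the upper half-plane and Re s > r, the Barnes zeta function is
e^{-πis/2}/Γ(s) times the Mellin transform of K = e^{izt}/∏(1 - e^{iω_j t}) (`kernel`). A linear
relation between directional derivatives of such kernels in (z, ω) therefore passes to the zeta
functions, first for Re s large, then by continuation to s = 0, and so to the logarithmic
derivatives of 1/Γ_r (`invGamma`).

The relations needed are elementary. Put q = e^{iω₂t}, a = e^{iω₁t}. The kernel of Γ₂(z+ω₂ | ω₁,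
2ω₂) is e^{izt}(1-a)⁻¹ q/(1-q²), and q d/dq [q/(1-q²)] = (q+q³)/(1-q²)². The right side is what the
triple gamma kernels with periods 2ω₂, 2ω₂, ω₁ at z+ω₂ and z+3ω₂ contribute, and ∂/∂ω₂ on the left
brings down the same factor it as ∂/∂z on the right. For the second identity (1-a)⁻¹ on the left
becomes a/(1-a)², which is a d/da of (1-a)⁻¹; hence the derivative in ω₁. The reflected gamma
factors obey the same relations with -z for z and an extra factor a, and a/(1-a) has the same a
d/da. The exponentials of Bernoulli polynomials leave a rational identity.

The work lies in the continuation. In s one subtracts the Taylor polynomial of t^r K at t = 0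
(`continuedZeta`); the result is jointly holomorphic in (s, z, ω), so ∂_s at 0 commutes with
parameter derivatives (`exists_directional_deriv_zeta`). In z the ladder relation `invGamma_succ`
raises z into the upper half-plane, so 1/Γ_r is holomorphic in (z, ω) for every z. Cleared of
denominators, a relation is then an identity of entire functions of z, which needs checking only for
large Im z (`fderiv_invGamma_div_eq_add`). -/

theorem circleIntegral_eq_setIntegral (f : ℂ → ℂ) (c : ℂ) (R : ℝ) :
    (∮ ζ in C(c, R), f ζ) =
      ∫ θ in Ioc 0 (2 * π), deriv (circleMap c R) θ * f (circleMap c R θ) := by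
  rw [circleIntegral, intervalIntegral.integral_of_le Real.two_pi_pos.le]
  rfl

variable {E : Type*} [NormedAddCommGroup E] [NormedSpace ℂ E]

/-- Cauchy's estimate in one variable, applied on each complex line through x: the line in direction
v stays in the ball for parameters up to ρ/‖v‖. -/
theorem norm_fderiv_le_of_norm_le {f : E → ℂ} {x : E} {ρ C : ℝ} (hρ : 0 < ρ)
    (hf : ∀ y ∈ closedBall x ρ, DifferentiableAt ℂ f y) (hC : ∀ y ∈ closedBall x ρ, ‖f y‖ ≤ C) :
    ‖fderiv ℂ f x‖ ≤ C / ρ := by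
  have hC0 : 0 ≤ C := (norm_nonneg _).trans (hC x (mem_closedBall_self hρ.le))
  refine ContinuousLinearMap.opNorm_le_bound _ (by positivity) fun v => ?_
  rcases eq_or_ne v 0 with rfl | hv
  · simp
  have hv' : 0 < ‖v‖ := norm_pos_iff.2 hv
  have hmem : ∀ τ ∈ closedBall (0 : ℂ) (ρ / ‖v‖), x + τ • v ∈ closedBall x ρ := by
    intro τ hτ
    rw [mem_closedBall_zero_iff, le_div_iff₀ hv'] at hτ
    simpa [norm_smul] using hτ
  have hline : ∀ τ : ℂ, HasDerivAt (fun τ : ℂ => x + τ • v) v τ := fun τ => by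
    simpa using ((hasDerivAt_id τ).smul_const v).const_add x
  have hd : DifferentiableOn ℂ (fun τ : ℂ => f (x + τ • v)) (closedBall 0 (ρ / ‖v‖)) :=
    fun τ hτ => ((hf _ (hmem τ hτ)).comp τ (hline τ).differentiableAt).differentiableWithinAt
  have h1 : deriv (fun τ : ℂ => f (x + τ • v)) 0 = fderiv ℂ f x v := by
    have h2 : DifferentiableAt ℂ f (x + (0 : ℂ) • v) := by
      simpa using hf x (mem_closedBall_self hρ.le)
    have := h2.hasFDerivAt.comp_hasDerivAt (0 : ℂ) (hline 0)
    simpa [Function.comp_def] using this.deriv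
  rw [← h1]
  refine (Complex.norm_deriv_le_of_forall_mem_sphere_norm_le (C := C) (div_pos hρ hv')
    (hd.mono closure_ball_subset_closedBall).diffContOnCl
    fun τ hτ => hC _ (hmem τ (sphere_subset_closedBall hτ))).trans_eq ?_
  field_simp

variable [FiniteDimensional ℂ E] {α : Type*} [MeasurableSpace α] {μ : Measure α}

/-- Each directional derivative is a limit of measurable difference quotients along x + v/(n+1); a
finite basis of E assembles them. -/
theorem aestronglyMeasurable_fderiv {F : E → α → ℂ} {U : Set E} (hU : IsOpen U)
    (hF : ∀ᵐ a ∂μ, DifferentiableOn ℂ (fun x => F x a) U)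
    (hm : ∀ x ∈ U, AEStronglyMeasurable (F x) μ) {x : E} (hx : x ∈ U) :
    AEStronglyMeasurable (fun a => fderiv ℂ (fun y => F y a) x) μ := by
  have key : ∀ v : E, AEStronglyMeasurable (fun a => fderiv ℂ (fun y => F y a) x v) μ := by
    intro v
    have ht : Tendsto (fun n : ℕ => x + ((n : ℂ) + 1)⁻¹ • v) atTop (𝓝 x) := by
      have h0 : Tendsto (fun n : ℕ => ((n : ℂ) + 1)⁻¹) atTop (𝓝 0) := by
        simpa using tendsto_one_div_add_atTop_nhds_zero_nat (𝕜 := ℂ)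
      simpa using (h0.smul_const v).const_add x
    obtain ⟨N, hN⟩ := eventually_atTop.1 (ht.eventually (hU.mem_nhds hx))
    -- The shift by N keeps every point of the sequence inside U.
    refine aestronglyMeasurable_of_tendsto_ae atTop
      (f := fun (n : ℕ) a => ((((n + N : ℕ) : ℂ) + 1)⁻¹)⁻¹ •
        (F (x + (((n + N : ℕ) : ℂ) + 1)⁻¹ • v) a - F x a)) (fun n => ?_) ?_
    · exact ((hm _ (hN _ (Nat.le_add_left N n))).sub (hm x hx)).const_smul ((((n + N : ℕ) : ℂ) + 1)⁻¹)⁻¹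
    · filter_upwards [hF] with a ha
      have hd := ((ha x hx).differentiableAt (hU.mem_nhds hx)).hasFDerivAt
      have hline : HasDerivAt (fun τ : ℂ => x + τ • v) v 0 := by
        simpa using ((hasDerivAt_id (0 : ℂ)).smul_const v).const_add x
      have h2 : HasDerivAt (fun τ : ℂ => F (x + τ • v) a) (fderiv ℂ (fun y => F y a) x v) 0 := by
        have h3 : HasFDerivAt (fun y => F y a) (fderiv ℂ (fun y => F y a) x)
          (x + (0 : ℂ) • v) := by simpa using hd
        exact h3.comp_hasDerivAt (0 : ℂ) hline
      have h0 : Tendsto (fun n : ℕ => (((n + N : ℕ) : ℂ) + 1)⁻¹) atTop (𝓝[≠] 0) := by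
        refine tendsto_nhdsWithin_iff.2 ⟨?_, Eventually.of_forall fun n => ?_⟩
        · have : Tendsto (fun n : ℕ => ((n : ℂ) + 1)⁻¹) atTop (𝓝 0) := by
            simpa using tendsto_one_div_add_atTop_nhds_zero_nat (𝕜 := ℂ)
          exact this.comp (tendsto_add_atTop_nat N)
        · exact inv_ne_zero (Nat.cast_add_one_ne_zero _)
      have := h2.tendsto_slope_zero.comp h0
      simpa [Function.comp_def] using this
  let b := Module.finBasis ℂ E
  have : (fun a => fderiv ℂ (fun y => F y a) x) = fun a =>
      ∑ i, (fderiv ℂ (fun y => F y a) x (b i)) • LinearMap.toContinuousLinearMap (b.coord i) := by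
    funext a
    ext v
    conv_lhs => rw [← b.sum_repr v, map_sum]
    simp [mul_comm]
  rw [this]
  exact Finset.aestronglyMeasurable_fun_sum _ fun i _ => (key (b i)).smul_const _

/-- A dominated integral of holomorphic functions may be differentiated under the integral sign;
no bound on the derivatives is required. -/
theorem hasFDerivAt_integral_of_norm_le {F : E → α → ℂ} {U : Set E} (hU : IsOpen U)
    (hF : ∀ᵐ a ∂μ, DifferentiableOn ℂ (fun x => F x a) U)
    (hm : ∀ x ∈ U, AEStronglyMeasurable (F x) μ) {bound : α → ℝ}
    (hb : ∀ᵐ a ∂μ, ∀ x ∈ U, ‖F x a‖ ≤ bound a) (hbi : Integrable bound μ) {x : E} (hx : x ∈ U) :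
    Integrable (fun a => fderiv ℂ (fun y => F y a) x) μ ∧
      HasFDerivAt (fun x => ∫ a, F x a ∂μ) (∫ a, fderiv ℂ (fun y => F y a) x ∂μ) x := by
  obtain ⟨ε, hε, hball⟩ := Metric.isOpen_iff.1 hU x hx
  have hsub : ∀ y ∈ ball x (ε / 3), ∀ w ∈ closedBall y (ε / 3), w ∈ U := by
    intro y hy w hw
    refine hball ?_
    rw [mem_ball] at hy ⊢
    rw [mem_closedBall] at hw
    linarith [dist_triangle w y x]
  -- Cauchy's estimate on balls of radius ε/3 turns the bound on F into an integrable bound on its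
  -- derivative.
  have hbd : ∀ᵐ a ∂μ, ∀ y ∈ ball x (ε / 3), ‖fderiv ℂ (fun y => F y a) y‖ ≤ bound a / (ε / 3) := by
    filter_upwards [hF, hb] with a h1 h2 y hy
    exact norm_fderiv_le_of_norm_le (by positivity)
      (fun w hw => (h1 w (hsub y hy w hw)).differentiableAt (hU.mem_nhds (hsub y hy w hw)))
      fun w hw => h2 w (hsub y hy w hw)
  have hmeas := aestronglyMeasurable_fderiv hU hF hm hx
  have hxb : x ∈ ball x (ε / 3) := mem_ball_self (by positivity)
  refine ⟨(hbi.div_const (ε / 3)).mono' hmeas ?_, ?_⟩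
  · filter_upwards [hbd] with a ha using ha x hxb
  · refine hasFDerivAt_integral_of_dominated_of_fderiv_le (bound := fun a => bound a / (ε / 3))
      (F' := fun y a => fderiv ℂ (fun y => F y a) y)
      (ball_mem_nhds x (by positivity : 0 < ε / 3)) ?_ ?_ hmeas hbd (hbi.div_const _) ?_
    · filter_upwards [hU.mem_nhds hx] with y hy using hm y hy
    · exact hbi.mono' (hm x hx) (by filter_upwards [hb] with a ha using ha x hx)
    · filter_upwards [hF] with a ha y hy
      have hyU : y ∈ U := hsub y hy y (mem_closedBall_self (by positivity))
      exact ((ha y hyU).differentiableAt (hU.mem_nhds hyU)).hasFDerivAt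

theorem fderiv_integral_apply {F : E → α → ℂ} {U : Set E} (hU : IsOpen U)
    (hF : ∀ᵐ a ∂μ, DifferentiableOn ℂ (fun x => F x a) U)
    (hm : ∀ x ∈ U, AEStronglyMeasurable (F x) μ) {bound : α → ℝ}
    (hb : ∀ᵐ a ∂μ, ∀ x ∈ U, ‖F x a‖ ≤ bound a) (hbi : Integrable bound μ) {x : E} (hx : x ∈ U)
    (v : E) :
    fderiv ℂ (fun x => ∫ a, F x a ∂μ) x v = ∫ a, fderiv ℂ (fun y => F y a) x v ∂μ := by
  obtain ⟨h1, h2⟩ := hasFDerivAt_integral_of_norm_le hU hF hm hb hbi hx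
  rw [h2.fderiv, ContinuousLinearMap.integral_apply h1]

theorem differentiableOn_integral_of_norm_le {F : E → α → ℂ} {U : Set E} (hU : IsOpen U)
    (hF : ∀ᵐ a ∂μ, DifferentiableOn ℂ (fun x => F x a) U)
    (hm : ∀ x ∈ U, AEStronglyMeasurable (F x) μ) {bound : α → ℝ}
    (hb : ∀ᵐ a ∂μ, ∀ x ∈ U, ‖F x a‖ ≤ bound a) (hbi : Integrable bound μ) :
    DifferentiableOn ℂ (fun x => ∫ a, F x a ∂μ) U := fun _ hx =>
  (hasFDerivAt_integral_of_norm_le hU hF hm hb hbi hx).2.differentiableAt.differentiableWithinAt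

section Circle

variable {F : E → ℂ → ℂ} {U : Set E} {c : ℂ} {R M : ℝ}

theorem fderiv_circleIntegral (hU : IsOpen U) (hR : 0 ≤ R)
    (hF : ∀ ζ ∈ sphere c R, DifferentiableOn ℂ (fun x => F x ζ) U)
    (hc : ∀ x ∈ U, ContinuousOn (F x) (sphere c R))
    (hM : ∀ x ∈ U, ∀ ζ ∈ sphere c R, ‖F x ζ‖ ≤ M) :
    DifferentiableOn ℂ (fun x => ∮ ζ in C(c, R), F x ζ) U ∧
      ∀ x ∈ U, ∀ v, fderiv ℂ (fun x => ∮ ζ in C(c, R), F x ζ) x v =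
        ∮ ζ in C(c, R), fderiv ℂ (fun y => F y ζ) x v := by
  simp only [circleIntegral_eq_setIntegral]
  have hs : ∀ θ, circleMap c R θ ∈ sphere c R := circleMap_mem_sphere c hR
  have h1 : ∀ᵐ θ ∂(volume.restrict (Ioc 0 (2 * π))), DifferentiableOn ℂ
      (fun x => deriv (circleMap c R) θ * F x (circleMap c R θ)) U :=
    Eventually.of_forall fun θ => (hF _ (hs θ)).const_mul _
  have h2 : ∀ x ∈ U, AEStronglyMeasurable
      (fun θ => deriv (circleMap c R) θ * F x (circleMap c R θ))
      (volume.restrict (Ioc 0 (2 * π))) := by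
    intro x hx
    refine Continuous.aestronglyMeasurable (Continuous.mul ?_ ?_)
    · have : deriv (circleMap c R) = fun θ => circleMap 0 R θ * Complex.I :=
        funext fun θ => deriv_circleMap c R θ
      rw [this]
      fun_prop
    · exact (hc x hx).comp_continuous (continuous_circleMap c R) hs
  have h3 : ∀ᵐ θ ∂(volume.restrict (Ioc 0 (2 * π))), ∀ x ∈ U,
      ‖deriv (circleMap c R) θ * F x (circleMap c R θ)‖ ≤ |R| * M := by
    refine Eventually.of_forall fun θ x hx => ?_
    rw [norm_mul]
    gcongr
    · simp
    · exact hM x hx _ (hs θ)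
  have h4 : Integrable (fun _ : ℝ => |R| * M) (volume.restrict (Ioc 0 (2 * π))) :=
    integrable_const _
  refine ⟨differentiableOn_integral_of_norm_le hU h1 h2 h3 h4, fun x hx v => ?_⟩
  rw [fderiv_integral_apply hU h1 h2 h3 h4 hx v]
  congr 1
  funext θ
  rw [fderiv_const_mul ((hF _ (hs θ) x hx).differentiableAt (hU.mem_nhds hx))]
  rfl

end Circle

/-- Directional derivatives of a holomorphic function of several variables are holomorphic. -/
theorem differentiableOn_fderiv_apply {f : E → ℂ} {U : Set E} (hU : IsOpen U)
    (hf : DifferentiableOn ℂ f U) (v : E) : DifferentiableOn ℂ (fun x => fderiv ℂ f x v) U := by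
  intro x hx
  obtain ⟨ε, hε, hball⟩ : ∃ ε > 0, ∀ y ∈ ball x ε, y ∈ U ∧ ‖f y‖ ≤ ‖f x‖ + 1 := by
    have h1 : ∀ᶠ y in 𝓝 x, ‖f y‖ < ‖f x‖ + 1 :=
      ((hf x hx).differentiableAt (hU.mem_nhds hx)).continuousAt.norm.eventually_lt
        continuousAt_const (by linarith)
    obtain ⟨ε, hε, h⟩ := Metric.eventually_nhds_iff_ball.1 (h1.and (hU.mem_nhds hx))
    exact ⟨ε, hε, fun y hy => ⟨(h y hy).2, (h y hy).1.le⟩⟩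
  obtain ⟨R, hR, hRv⟩ : ∃ R > 0, R * ‖v‖ < ε / 2 := by
    refine ⟨ε / 2 / (‖v‖ + 1), by positivity, ?_⟩
    rw [div_mul_eq_mul_div, div_lt_iff₀ (by positivity)]
    nlinarith [norm_nonneg v]
  have hmem : ∀ y ∈ ball x (ε / 2), ∀ τ ∈ closedBall (0 : ℂ) R, y + τ • v ∈ ball x ε := by
    intro y hy τ hτ
    rw [mem_closedBall_zero_iff] at hτ
    rw [mem_ball_iff_norm] at hy ⊢
    calc ‖y + τ • v - x‖ = ‖(y - x) + τ • v‖ := by congr 1; abel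
      _ ≤ ‖y - x‖ + ‖τ • v‖ := norm_add_le _ _
      _ < ε / 2 + ε / 2 := by
        refine add_lt_add hy (lt_of_le_of_lt ?_ hRv)
        rw [norm_smul]; gcongr
      _ = ε := by ring
  have hdf : ∀ y ∈ ball x ε, DifferentiableAt ℂ f y := fun y hy =>
    (hf y (hball y hy).1).differentiableAt (hU.mem_nhds (hball y hy).1)
  -- Cauchy's formula along v expresses the derivative through values of f alone, so the integrand
  -- is holomorphic in y.
  have hcirc : ∀ y ∈ ball x (ε / 2), fderiv ℂ f y v =
      (2 * π * Complex.I)⁻¹ * ∮ ζ in C(0, R), ζ⁻¹ ^ 2 * f (y + ζ • v) := by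
    intro y hy
    have hline : ∀ τ : ℂ, HasDerivAt (fun τ : ℂ => y + τ • v) v τ := fun τ => by
      simpa using ((hasDerivAt_id τ).smul_const v).const_add y
    have hd : DifferentiableOn ℂ (fun τ : ℂ => f (y + τ • v)) (closedBall 0 R) := fun τ hτ =>
      ((hdf _ (hmem y hy τ hτ)).comp τ (hline τ).differentiableAt).differentiableWithinAt
    have := (hd.mono closure_ball_subset_closedBall).diffContOnCl
      |>.circleIntegral_one_div_sub_center_pow_smul hR 1
    have h1 : deriv (fun τ : ℂ => f (y + τ • v)) 0 = fderiv ℂ f y v := by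
      have h2 : DifferentiableAt ℂ f (y + (0 : ℂ) • v) :=
        hdf _ (hmem y hy 0 (mem_closedBall_self hR.le))
      have := h2.hasFDerivAt.comp_hasDerivAt (0 : ℂ) (hline 0)
      simpa [Function.comp_def] using this.deriv
    rw [← h1]
    have hpi : (2 * π * Complex.I : ℂ) ≠ 0 := Complex.two_pi_I_ne_zero
    simp only [sub_zero, one_div, smul_eq_mul, Nat.factorial_one, Nat.cast_one, div_one,
      iteratedDeriv_one] at this
    rw [eq_inv_mul_iff_mul_eq₀ hpi, ← this]
    simp [inv_pow]
  have key := (fderiv_circleIntegral (F := fun y ζ => ζ⁻¹ ^ 2 * f (y + ζ • v)) (U := ball x (ε / 2))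
    (c := 0) (R := R) (M := R⁻¹ ^ 2 * (‖f x‖ + 1)) isOpen_ball hR.le ?_ ?_ ?_).1
  · have hx' : x ∈ ball x (ε / 2) := mem_ball_self (by positivity)
    have h1 := ((key.const_mul (2 * π * Complex.I : ℂ)⁻¹) x hx').differentiableAt
      (isOpen_ball.mem_nhds hx')
    refine (h1.congr_of_eventuallyEq ?_).differentiableWithinAt
    filter_upwards [isOpen_ball.mem_nhds hx'] with y hy using hcirc y hy
  · intro ζ hζ y hy
    refine (DifferentiableAt.const_mul ?_ _).differentiableWithinAt
    exact (hdf _ (hmem y hy ζ (sphere_subset_closedBall hζ))).comp y (by fun_prop)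
  · intro y hy ζ hζ
    have hζ0 : ζ ≠ 0 := by
      rintro rfl
      simp [hR.ne] at hζ
    refine ContinuousWithinAt.mul ?_ ?_
    · exact ((continuousAt_inv₀ hζ0).pow 2).continuousWithinAt
    · have : ContinuousAt (fun ζ : ℂ => f (y + ζ • v)) ζ :=
        (hdf _ (hmem y hy ζ (sphere_subset_closedBall hζ))).continuousAt.comp
          (f := fun ζ : ℂ => y + ζ • v) (by fun_prop)
      exact this.continuousWithinAt
  · intro y hy ζ hζ
    have hn : ‖ζ‖ = R := by simpa using hζ
    rw [norm_mul, norm_pow, norm_inv, hn]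
    gcongr
    exact (hball _ (hmem y hy ζ (sphere_subset_closedBall hζ))).2

end HolomorphicIntegrals

/-! ### The Barnes zeta series as a Mellin transform -/

theorem hasSum_pi_geometric {𝕜 : Type*} [RCLike 𝕜] : ∀ {r : ℕ} {a : Fin r → 𝕜}, (∀ i, ‖a i‖ < 1) →
    Summable (fun n : Fin r → ℕ => ‖∏ i, a i ^ n i‖) ∧
      HasSum (fun n : Fin r → ℕ => ∏ i, a i ^ n i) (∏ i, (1 - a i)⁻¹)
  | 0, a, _ => by
    refine ⟨(hasSum_fintype _).summable, ?_⟩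
    simp
  | r + 1, a, ha => by
    obtain ⟨h1, h2⟩ := hasSum_pi_geometric (a := Fin.tail a) fun i => ha i.succ
    have h3 := hasSum_geometric_of_norm_lt_one (ha 0)
    have h4 : Summable fun n : ℕ => ‖a 0 ^ n‖ := by
      simpa using summable_geometric_of_lt_one (norm_nonneg _) (ha 0)
    have h5 := h4.mul_of_nonneg h1 (fun _ => norm_nonneg _) fun _ => norm_nonneg _
    have h6 : ∀ x : ℕ × (Fin r → ℕ), ∏ i, a i ^ (Fin.consEquiv (fun _ => ℕ) x) i =
        a 0 ^ x.1 * ∏ i, Fin.tail a i ^ x.2 i := fun x => by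
      simp [Fin.prod_univ_succ, Fin.consEquiv, Fin.tail]
    constructor
    · rw [← (Fin.consEquiv fun _ => ℕ).summable_iff]
      refine h5.congr fun x => ?_
      rw [Function.comp_apply, h6, norm_mul]
    · rw [← (Fin.consEquiv fun _ => ℕ).hasSum_iff]
      have h7 := h3.mul h2 (Summable.of_norm (by simpa only [norm_mul] using h5))
      rw [Fin.prod_univ_succ]
      simp only [Function.comp_def, h6]
      exact h7

/-- The generating function `e ^ (i z t) / ∏ (1 - e ^ (i ω_j t))` whose Mellin transform is the
Barnes zeta function, as a function of `t` and `p = (z, ω)`. -/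
noncomputable def kernel {r : ℕ} (t : ℂ) (p : ℂ × (Fin r → ℂ)) : ℂ :=
  Complex.exp (Complex.I * p.1 * t) * ∏ i, (1 - Complex.exp (Complex.I * p.2 i * t))⁻¹

theorem norm_exp_I_mul (x : ℂ) (t : ℝ) :
    ‖Complex.exp (Complex.I * x * t)‖ = Real.exp (-(x.im * t)) := by
  rw [Complex.norm_exp]
  simp

theorem norm_exp_I_mul_lt_one {x : ℂ} (hx : 0 < x.im) {t : ℝ} (ht : 0 < t) :
    ‖Complex.exp (Complex.I * x * t)‖ < 1 := by
  rw [norm_exp_I_mul, Real.exp_lt_one_iff]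
  have := mul_pos hx ht
  linarith

/-- From e^u ≥ 1 + u. Each factor of the kernel thus costs at most one power of 1/t near 0. -/
theorem inv_one_sub_exp_neg_le {b x : ℝ} (hb : 0 < b) (hx : b ≤ x) {t : ℝ} (ht : 0 < t) :
    (1 - Real.exp (-(x * t)))⁻¹ ≤ 1 + (b * t)⁻¹ := by
  have hbt : 0 < b * t := mul_pos hb ht
  have h1 : Real.exp (-(x * t)) ≤ (1 + b * t)⁻¹ := by
    rw [Real.exp_neg]
    refine inv_anti₀ (by positivity) ?_
    have h2 : b * t ≤ x * t := by gcongr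
    linarith [Real.add_one_le_exp (x * t)]
  have h3 : b * t * (1 + b * t)⁻¹ ≤ 1 - Real.exp (-(x * t)) := by
    have : b * t * (1 + b * t)⁻¹ = 1 - (1 + b * t)⁻¹ := by field_simp; ring
    linarith
  refine (inv_anti₀ (by positivity) h3).trans_eq ?_
  field_simp
  ring

/-- The function majorizing `kernel` on `(0, ∞)`. -/
theorem majorant_le {r : ℕ} {p : ℂ × (Fin r → ℂ)} {y b : ℝ} (hb : 0 < b)
    (h1 : y ≤ p.1.im) (h2 : ∀ i, b ≤ (p.2 i).im) {t : ℝ} (ht : 0 < t) :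
    Real.exp (-(p.1.im * t)) * ∏ i, (1 - Real.exp (-((p.2 i).im * t)))⁻¹ ≤
      Real.exp (-(y * t)) * (1 + (b * t)⁻¹) ^ r := by
  have h3 : ∀ i, 0 ≤ (1 - Real.exp (-((p.2 i).im * t)))⁻¹ := fun i => by
    rw [inv_nonneg, sub_nonneg, Real.exp_le_one_iff]
    have := mul_pos (hb.trans_le (h2 i)) ht
    linarith
  refine mul_le_mul ?_ ?_ (Finset.prod_nonneg fun i _ => h3 i) (Real.exp_nonneg _)
  · gcongr
  · refine (Finset.prod_le_prod (fun i _ => h3 i)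
      fun i _ => inv_one_sub_exp_neg_le hb (h2 i) ht).trans_eq ?_
    simp

theorem norm_kernel_le {r : ℕ} {p : ℂ × (Fin r → ℂ)} {y b : ℝ} (hb : 0 < b)
    (h1 : y ≤ p.1.im) (h2 : ∀ i, b ≤ (p.2 i).im) {t : ℝ} (ht : 0 < t) :
    ‖kernel (t : ℂ) p‖ ≤ Real.exp (-(y * t)) * (1 + (b * t)⁻¹) ^ r := by
  refine le_trans ?_ (majorant_le hb h1 h2 ht)
  rw [kernel, norm_mul, norm_exp_I_mul, norm_prod]
  gcongr with i
  rw [norm_inv]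
  have h3 := norm_exp_I_mul_lt_one (hb.trans_le (h2 i)) ht
  refine inv_anti₀ (by rw [← norm_exp_I_mul]; linarith) ?_
  rw [← norm_exp_I_mul]
  simpa using norm_sub_norm_le (1 : ℂ) (Complex.exp (Complex.I * p.2 i * t))

/-- Since (1 + u)^r ≤ 2^{r-1}(1 + u^r), two Gamma integrals suffice, with exponents σ - 1 and σ - 1
- r; both exceed -1 because σ > r. -/
theorem integrableOn_majorant {r : ℕ} {y b σ : ℝ} (hy : 0 < y) (hb : 0 < b) (hσ : r < σ) :
    IntegrableOn (fun t : ℝ => t ^ (σ - 1) * (Real.exp (-(y * t)) * (1 + (b * t)⁻¹) ^ r))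
      (Ioi 0) := by
  have key : ∀ {q : ℝ}, -1 < q → IntegrableOn (fun t : ℝ => t ^ q * Real.exp (-(y * t)))
      (Ioi 0) := fun {q} hq => by
    simpa using integrableOn_rpow_mul_exp_neg_mul_rpow hq one_pos hy
  have h1 := key (q := σ - 1) (by linarith [(Nat.cast_nonneg r : (0 : ℝ) ≤ r)])
  have h2 := key (q := σ - 1 - r) (by linarith)
  have h3 : IntegrableOn (fun t : ℝ => 2 ^ (r - 1) * (t ^ (σ - 1) * Real.exp (-(y * t)) +
      (b⁻¹) ^ r * (t ^ (σ - 1 - r) * Real.exp (-(y * t))))) (Ioi 0) :=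
    (h1.add (h2.const_mul _)).const_mul _
  refine Integrable.mono' h3 ?_ ?_
  · refine (ContinuousOn.mul ?_ (ContinuousOn.mul (by fun_prop)
      (ContinuousOn.pow (continuousOn_const.add (ContinuousOn.inv₀ (by fun_prop) ?_)) _)))
      |>.aestronglyMeasurable measurableSet_Ioi
    · exact fun t ht => (Real.continuousAt_rpow_const _ _ (Or.inl (ne_of_gt ht))).continuousWithinAt
    · exact fun t ht => (mul_pos hb ht).ne'
  · filter_upwards [self_mem_ae_restrict measurableSet_Ioi] with t ht
    have ht : 0 < t := ht
    rw [Real.norm_of_nonneg (by positivity)]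
    calc t ^ (σ - 1) * (Real.exp (-(y * t)) * (1 + (b * t)⁻¹) ^ r)
        ≤ t ^ (σ - 1) * (Real.exp (-(y * t)) * (2 ^ (r - 1) * (1 ^ r + ((b * t)⁻¹) ^ r))) := by
          gcongr
          exact add_pow_le zero_le_one (by positivity) r
      _ = _ := by
        rw [Real.rpow_sub ht (σ - 1), Real.rpow_natCast, mul_inv, mul_pow, one_pow, inv_pow t]
        field_simp

/-- Here 0 ≤ arg x ≤ π, so πi/2 - log x lies in the principal strip and equals log(i/x). -/
theorem I_div_cpow {x : ℂ} (hx : 0 < x.im) (s : ℂ) :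
    (Complex.I / x) ^ s = Complex.exp (π * Complex.I / 2 * s) * x ^ (-s) := by
  have hx0 : x ≠ 0 := by rintro rfl; simp at hx
  have h1 : Complex.log (Complex.I / x) = π * Complex.I / 2 - Complex.log x := by
    have h2 : Complex.I / x = Complex.exp (π * Complex.I / 2 - Complex.log x) := by
      rw [Complex.exp_sub, Complex.exp_log hx0]
      congr 1
      rw [mul_div_right_comm, Complex.exp_pi_div_two_mul_I]
    have h3 : (π * Complex.I / 2 - Complex.log x : ℂ).im = π / 2 - x.arg := by
      simp [Complex.log_im]
    rw [h2, Complex.log_exp]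
    · rw [h3]; linarith [Complex.arg_le_pi x, Real.pi_pos]
    · rw [h3]; linarith [Complex.arg_nonneg_iff.2 hx.le, Real.pi_pos]
  rw [Complex.cpow_def_of_ne_zero (div_ne_zero Complex.I_ne_zero hx0), h1,
    Complex.cpow_def_of_ne_zero hx0, ← Complex.exp_add]
  ring_nf

theorem aestronglyMeasurable_cpow_mul_exp (s x : ℂ) :
    AEStronglyMeasurable (fun t : ℝ => (t : ℂ) ^ (s - 1) * Complex.exp (Complex.I * x * t))
      (volume.restrict (Ioi 0)) := by
  refine ContinuousOn.aestronglyMeasurable (ContinuousOn.mul ?_ (by fun_prop)) measurableSet_Ioi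
  exact fun t ht => (Complex.continuousAt_ofReal_cpow_const t (s - 1)
    (Or.inr (ne_of_gt ht))).continuousWithinAt

/-- Both sides are holomorphic in x. At x = iu with u > 0 this is Euler's integral, and the points u
= 1 + 1/(n+1) accumulate at x = i, so the identity theorem applies. -/
theorem integral_cpow_mul_exp_I {x s : ℂ} (hx : 0 < x.im) (hs : 0 < s.re) :
    ∫ t : ℝ in Ioi 0, (t : ℂ) ^ (s - 1) * Complex.exp (Complex.I * x * t) =
      Complex.exp (π * Complex.I / 2 * s) * Complex.Gamma s * x ^ (-s) := by
  have hopen : IsOpen {x : ℂ | 0 < x.im} := isOpen_lt continuous_const Complex.continuous_im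
  have hd : DifferentiableOn ℂ (fun x : ℂ => ∫ t : ℝ in Ioi 0, (t : ℂ) ^ (s - 1) *
      Complex.exp (Complex.I * x * t)) {x | 0 < x.im} := by
    intro x₀ hx₀
    have hx₀ : 0 < x₀.im := hx₀
    have hU : IsOpen {x : ℂ | x₀.im / 2 < x.im} := isOpen_lt continuous_const Complex.continuous_im
    have hmem : x₀ ∈ {x : ℂ | x₀.im / 2 < x.im} := half_lt_self hx₀
    refine ((differentiableOn_integral_of_norm_le (μ := volume.restrict (Ioi (0 : ℝ)))
      (F := fun (x : ℂ) (t : ℝ) => (t : ℂ) ^ (s - 1) * Complex.exp (Complex.I * x * t))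
      (bound := fun t => t ^ (s.re - 1) * Real.exp (-(x₀.im / 2 * t))) hU
      (Eventually.of_forall fun t => Differentiable.differentiableOn (by fun_prop))
      (fun x _ => aestronglyMeasurable_cpow_mul_exp s x) ?_ ?_) x₀ hmem).differentiableAt
      (hU.mem_nhds hmem) |>.differentiableWithinAt
    · filter_upwards [self_mem_ae_restrict measurableSet_Ioi] with t ht x hx
      have ht : 0 < t := ht
      have hx : x₀.im / 2 < x.im := hx
      rw [norm_mul, Complex.norm_cpow_eq_rpow_re_of_pos ht, norm_exp_I_mul]
      simp only [Complex.sub_re, Complex.one_re]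
      gcongr
    · have := integrableOn_rpow_mul_exp_neg_mul_rpow (s := s.re - 1) (by linarith) one_pos
        (half_pos hx₀)
      simpa [IntegrableOn] using this
  have hd2 : DifferentiableOn ℂ (fun x : ℂ => Complex.exp (π * Complex.I / 2 * s) *
      Complex.Gamma s * x ^ (-s)) {x | 0 < x.im} := by
    intro x hx
    refine (DifferentiableAt.const_mul (differentiableAt_id.cpow_const ?_) _)
      |>.differentiableWithinAt
    exact Or.inr (ne_of_gt hx)
  refine AnalyticOnNhd.eqOn_of_preconnected_of_frequently_eq (hd.analyticOnNhd hopen)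
    (hd2.analyticOnNhd hopen) (convex_halfSpace_im_gt 0).isPreconnected
    (z₀ := Complex.I) (by simp) ?_ hx
  have ht : Tendsto (fun n : ℕ => Complex.I * ((1 + 1 / ((n : ℝ) + 1) : ℝ) : ℂ)) atTop
      (𝓝[≠] Complex.I) := by
    refine tendsto_nhdsWithin_iff.2 ⟨?_, Eventually.of_forall fun n => ?_⟩
    · have h1 : Tendsto (fun n : ℕ => (1 + 1 / ((n : ℝ) + 1) : ℝ)) atTop (𝓝 1) := by
        simpa using tendsto_one_div_add_atTop_nhds_zero_nat (𝕜 := ℝ).const_add 1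
      have h2 := (Complex.continuous_ofReal.tendsto 1).comp h1
      simpa using h2.const_mul Complex.I
    · intro h
      have h1 : Complex.I * ((1 + 1 / ((n : ℝ) + 1) : ℝ) : ℂ) = Complex.I * (1 : ℝ) := by
        simpa using h
      have h2 := Complex.ofReal_injective (mul_left_cancel₀ Complex.I_ne_zero h1)
      have : (0 : ℝ) < 1 / ((n : ℝ) + 1) := by positivity
      linarith
  refine ht.frequently (Eventually.frequently (Eventually.of_forall fun n => ?_))
  set u : ℝ := 1 + 1 / ((n : ℝ) + 1) with hu
  have hu0 : 0 < u := by positivity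
  have h := Complex.integral_cpow_mul_exp_neg_mul_Ioi hs hu0
  have h1 : (1 / u : ℂ) = Complex.I / (Complex.I * u) := by
    rw [div_mul_eq_div_div, div_self Complex.I_ne_zero]
  rw [h1, I_div_cpow (by simpa using hu0)] at h
  rw [mul_right_comm, ← h]
  refine setIntegral_congr_fun measurableSet_Ioi fun t _ => ?_
  rw [← mul_assoc Complex.I, Complex.I_mul_I]
  congr 2
  ring

/-- Expand the kernel in geometric series and integrate term by term. The norms of the terms sum in
closed form to the analogous real kernel, which is integrable as Re s > r, so dominated convergence
applies. -/
theorem hasSum_barnesZeta_integral {r : ℕ} {p : ℂ × (Fin r → ℂ)} (hz : 0 < p.1.im)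
    (hω : ∀ i, 0 < (p.2 i).im) {s : ℂ} (hs : r < s.re) :
    HasSum (fun n : Fin r → ℕ => (p.1 + dot n p.2) ^ (-s))
      (Complex.exp (-(π * Complex.I / 2 * s)) * (Complex.Gamma s)⁻¹ *
        ∫ t : ℝ in Ioi 0, (t : ℂ) ^ (s - 1) * kernel t p) := by
  have hs0 : 0 < s.re := (Nat.cast_nonneg r).trans_lt hs
  have him : ∀ n : Fin r → ℕ, 0 < (p.1 + dot n p.2).im := fun n => by
    simp only [dot, Complex.add_im, Complex.im_sum, Complex.mul_im, Complex.natCast_re,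
      Complex.natCast_im, zero_mul, add_zero]
    exact add_pos_of_pos_of_nonneg hz
      (Finset.sum_nonneg fun i _ => mul_nonneg (Nat.cast_nonneg _) (hω i).le)
  have hexp : ∀ (n : Fin r → ℕ) (t : ℝ), Complex.exp (Complex.I * (p.1 + dot n p.2) * t) =
      Complex.exp (Complex.I * p.1 * t) * ∏ i, Complex.exp (Complex.I * p.2 i * t) ^ n i := by
    intro n t
    simp only [← Complex.exp_nat_mul, ← Complex.exp_sum, ← Complex.exp_add]
    congr 1
    rw [dot, mul_add, add_mul, Finset.mul_sum, Finset.sum_mul]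
    congr 1
    exact Finset.sum_congr rfl fun i _ => by ring
  obtain ⟨b, hb, hbω⟩ : ∃ b > 0, ∀ i, b ≤ (p.2 i).im := by
    rcases isEmpty_or_nonempty (Fin r) with h | h
    · exact ⟨1, one_pos, fun i => (h.false i).elim⟩
    · obtain ⟨i, hi⟩ := Finite.exists_min fun i => (p.2 i).im
      exact ⟨_, hω i, hi⟩
  have hnorm : ∀ (n : Fin r → ℕ) (t : ℝ), 0 < t →
      ‖(t : ℂ) ^ (s - 1) * Complex.exp (Complex.I * (p.1 + dot n p.2) * t)‖ =
        t ^ (s.re - 1) * Real.exp (-(p.1.im * t)) *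
          ∏ i, Real.exp (-((p.2 i).im * t)) ^ n i := by
    intro n t ht
    rw [hexp, norm_mul, norm_mul, Complex.norm_cpow_eq_rpow_re_of_pos ht, norm_prod,
      norm_exp_I_mul, mul_assoc]
    simp [norm_exp_I_mul]
  have hgeo : ∀ t : ℝ, 0 < t → HasSum (fun n : Fin r → ℕ =>
      ‖(t : ℂ) ^ (s - 1) * Complex.exp (Complex.I * (p.1 + dot n p.2) * t)‖)
      (t ^ (s.re - 1) * Real.exp (-(p.1.im * t)) *
          ∏ i, (1 - Real.exp (-((p.2 i).im * t)))⁻¹) := by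
    intro t ht
    simp only [hnorm _ t ht]
    refine ((hasSum_pi_geometric (𝕜 := ℝ) (a := fun i => Real.exp (-((p.2 i).im * t)))
      fun i => ?_).2).mul_left _
    rw [Real.norm_of_nonneg (Real.exp_nonneg _), Real.exp_lt_one_iff]
    have := mul_pos (hω i) ht
    linarith
  have key := hasSum_integral_of_dominated_convergence (μ := volume.restrict (Ioi (0 : ℝ)))
    (F := fun (n : Fin r → ℕ) (t : ℝ) =>
      (t : ℂ) ^ (s - 1) * Complex.exp (Complex.I * (p.1 + dot n p.2) * t))
    (f := fun t : ℝ => (t : ℂ) ^ (s - 1) * kernel t p)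
    (fun n t => ‖(t : ℂ) ^ (s - 1) * Complex.exp (Complex.I * (p.1 + dot n p.2) * t)‖)
    (fun n => aestronglyMeasurable_cpow_mul_exp s _) (fun n => Eventually.of_forall fun t => le_rfl) ?_ ?_ ?_
  · simp only [fun n => integral_cpow_mul_exp_I (him n) hs0] at key
    have h := key.mul_left
      (Complex.exp (-(π * Complex.I / 2 * s)) * (Complex.Gamma s)⁻¹)
    have hΓ := Complex.Gamma_ne_zero_of_re_pos hs0
    have hfun : ∀ n : Fin r → ℕ, (p.1 + dot n p.2) ^ (-s) =
        Complex.exp (-(π * Complex.I / 2 * s)) * (Complex.Gamma s)⁻¹ *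
          (Complex.exp (π * Complex.I / 2 * s) * Complex.Gamma s * (p.1 + dot n p.2) ^ (-s)) := by
      intro n
      rw [Complex.exp_neg]
      field_simp
    rw [funext hfun]
    exact h
  · filter_upwards [self_mem_ae_restrict measurableSet_Ioi] with t ht using (hgeo t ht).summable
  · refine (integrableOn_majorant hz hb hs).mono' ?_ ?_
    · refine AEStronglyMeasurable.congr (f := fun t : ℝ => t ^ (s.re - 1) *
        Real.exp (-(p.1.im * t)) * ∏ i, (1 - Real.exp (-((p.2 i).im * t)))⁻¹) ?_ ?_
      · exact Measurable.aestronglyMeasurable (by fun_prop)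
      · filter_upwards [self_mem_ae_restrict measurableSet_Ioi] with t ht
        exact (hgeo t ht).tsum_eq.symm
    · filter_upwards [self_mem_ae_restrict measurableSet_Ioi] with t ht
      rw [Real.norm_of_nonneg (tsum_nonneg fun _ => norm_nonneg _), (hgeo t ht).tsum_eq, mul_assoc]
      exact mul_le_mul_of_nonneg_left (majorant_le hb le_rfl hbω ht)
        (Real.rpow_nonneg (le_of_lt ht) _)
  · filter_upwards [self_mem_ae_restrict measurableSet_Ioi] with t ht
    simp only [hexp, kernel]
    exact (((hasSum_pi_geometric fun i => norm_exp_I_mul_lt_one (hω i) ht).2).mul_left _).mul_left _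

/-! ### Expansion of the kernel at t = 0 -/

/-- The Taylor coefficient of order `k` at `0`, as a Cauchy integral. -/
noncomputable def taylorCoeff (R : ℝ) (f : ℂ → ℂ) (k : ℕ) : ℂ :=
  (2 * π * Complex.I)⁻¹ * ∮ ξ in C(0, R), (ξ ^ (k + 1))⁻¹ * f ξ

/-- The remainder is the Cauchy integral of t^n f(ξ)/(ξ^n(ξ - t)), and |ξ - t| ≥ R/2 on the circle.
The Cauchy form of the coefficients makes everything holomorphic in further parameters. -/
theorem norm_sub_sum_taylorCoeff_le {R C : ℝ} (hR : 0 < R) {f : ℂ → ℂ}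
    (hf : DifferentiableOn ℂ f (closedBall 0 R)) (hC : ∀ ξ ∈ closedBall (0 : ℂ) R, ‖f ξ‖ ≤ C)
    (n : ℕ) {t : ℂ} (ht : ‖t‖ ≤ R / 2) :
    ‖f t - ∑ k ∈ Finset.range n, taylorCoeff R f k * t ^ k‖ ≤ 2 * C / R ^ n * ‖t‖ ^ n := by
  have hsphere : ∀ ξ ∈ sphere (0 : ℂ) R, ‖ξ‖ = R ∧ ξ ≠ 0 ∧ ξ - t ≠ 0 := by
    intro ξ hξ
    have h1 : ‖ξ‖ = R := by simpa using hξ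
    refine ⟨h1, fun h => by simp [h, hR.ne] at h1, fun h => ?_⟩
    rw [sub_eq_zero.1 h] at h1
    linarith
  have hfc : ContinuousOn f (sphere 0 R) := hf.continuousOn.mono sphere_subset_closedBall
  have hint1 : CircleIntegrable (fun ξ => (ξ - t)⁻¹ • f ξ) 0 R := by
    refine ContinuousOn.circleIntegrable hR.le (ContinuousOn.smul (ContinuousOn.inv₀ (by fun_prop)
      fun ξ hξ => (hsphere ξ hξ).2.2) hfc)
  have hint2 : ∀ k : ℕ, CircleIntegrable (fun ξ => t ^ k * ((ξ ^ (k + 1))⁻¹ * f ξ)) 0 R :=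
    fun k => ContinuousOn.circleIntegrable hR.le (continuousOn_const.mul
      ((ContinuousOn.inv₀ (by fun_prop) fun ξ hξ => pow_ne_zero _ (hsphere ξ hξ).2.1).mul hfc))
  have ht' : t ∈ ball (0 : ℂ) R := by
    rw [mem_ball_zero_iff]; linarith
  have h1 := hf.circleIntegral_sub_inv_smul ht'
  have h2 : f t - ∑ k ∈ Finset.range n, taylorCoeff R f k * t ^ k =
      (2 * π * Complex.I : ℂ)⁻¹ • ∮ ξ in C(0, R), (t ^ n / (ξ ^ n * (ξ - t))) * f ξ := by
    have h3 : (∮ ξ in C(0, R), (t ^ n / (ξ ^ n * (ξ - t))) * f ξ) =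
        (∮ ξ in C(0, R), (ξ - t)⁻¹ • f ξ) -
          ∑ k ∈ Finset.range n, ∮ ξ in C(0, R), t ^ k * ((ξ ^ (k + 1))⁻¹ * f ξ) := by
      rw [← circleIntegral.integral_fun_sum fun k _ => hint2 k, ← circleIntegral.integral_sub hint1
        (CircleIntegrable.fun_sum _ fun k _ => hint2 k)]
      refine circleIntegral.integral_congr hR.le fun ξ hξ => ?_
      obtain ⟨-, hξ0, hξt⟩ := hsphere ξ hξ
      have hgeo : ∑ k ∈ Finset.range n, t ^ k * (ξ ^ (k + 1))⁻¹ =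
          (ξ - t)⁻¹ - t ^ n / (ξ ^ n * (ξ - t)) := by
        induction n with
        | zero => simp
        | succ n ih =>
          rw [Finset.sum_range_succ, ih]
          field_simp
          ring
      simp only [smul_eq_mul, ← mul_assoc, ← Finset.sum_mul, hgeo]
      ring
    rw [h3, h1]
    simp only [circleIntegral.integral_const_mul, taylorCoeff, smul_eq_mul, mul_sub,
      Finset.mul_sum]
    rw [inv_mul_cancel_left₀ Complex.two_pi_I_ne_zero]
    congr 1
    exact Finset.sum_congr rfl fun k _ => by ring
  rw [h2]
  refine (circleIntegral.norm_two_pi_i_inv_smul_integral_le_of_norm_le_const hR.le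
    (C := ‖t‖ ^ n / (R ^ n * (R / 2)) * C) fun ξ hξ => ?_).trans_eq ?_
  · obtain ⟨hn, hξ0, hξt⟩ := hsphere ξ hξ
    rw [norm_mul, norm_div, norm_mul, norm_pow, norm_pow, hn]
    have h4 : R / 2 ≤ ‖ξ - t‖ := by
      have := norm_sub_norm_le ξ t
      linarith
    have h5 : ‖f ξ‖ ≤ C := hC ξ (sphere_subset_closedBall hξ)
    gcongr
  · field_simp

theorem differentiableOn_taylorCoeff {E : Type*} [NormedAddCommGroup E] [NormedSpace ℂ E]
    [FiniteDimensional ℂ E] {U : Set E} (hU : IsOpen U) {R C : ℝ} (hR : 0 < R) {f : ℂ → E → ℂ}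
    (hf : ∀ x ∈ U, ContinuousOn (fun ξ => f ξ x) (sphere 0 R))
    (hf' : ∀ ξ ∈ sphere (0 : ℂ) R, DifferentiableOn ℂ (f ξ) U)
    (hC : ∀ x ∈ U, ∀ ξ ∈ sphere (0 : ℂ) R, ‖f ξ x‖ ≤ C) (k : ℕ) :
    DifferentiableOn ℂ (fun x => taylorCoeff R (fun ξ => f ξ x) k) U := by
  have hne : ∀ ξ ∈ sphere (0 : ℂ) R, ξ ≠ 0 := by
    rintro ξ hξ rfl
    simp [hR.ne] at hξ
  refine ((fderiv_circleIntegral (F := fun x ξ => (ξ ^ (k + 1))⁻¹ * f ξ x)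
    (M := (R ^ (k + 1))⁻¹ * C) hU hR.le (fun ξ hξ => (hf' ξ hξ).const_mul _) (fun x hx => ?_)
    fun x hx ξ hξ => ?_).1).const_mul _
  · exact (ContinuousOn.inv₀ (by fun_prop) fun ξ hξ => pow_ne_zero _ (hne ξ hξ)).mul (hf x hx)
  · have h1 : ‖ξ‖ = R := by simpa using hξ
    rw [norm_mul, norm_inv, norm_pow, h1]
    gcongr
    exact hC x hx ξ hξ

/-- The holomorphic extension `t ^ r * kernel t p` across `t = 0`. -/
noncomputable def regularKernel {r : ℕ} (t : ℂ) (p : ℂ × (Fin r → ℂ)) : ℂ :=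
  Complex.exp (Complex.I * p.1 * t) *
    ∏ i, (p.2 i * dslope (fun u : ℂ => 1 - Complex.exp (Complex.I * u)) 0 (p.2 i * t))⁻¹

theorem pow_mul_kernel {r : ℕ} {t : ℂ} (ht : t ≠ 0) (p : ℂ × (Fin r → ℂ)) :
    t ^ r * kernel t p = regularKernel t p := by
  have h1 : ∀ i, (1 - Complex.exp (Complex.I * p.2 i * t))⁻¹ = t⁻¹ *
      (p.2 i * dslope (fun u : ℂ => 1 - Complex.exp (Complex.I * u)) 0 (p.2 i * t))⁻¹ := by
    intro i
    rw [← mul_inv]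
    congr 1
    have := sub_smul_dslope (fun u : ℂ => 1 - Complex.exp (Complex.I * u)) 0 (p.2 i * t)
    simp only [sub_zero, smul_eq_mul, mul_zero, Complex.exp_zero, sub_self] at this
    rw [mul_assoc Complex.I, ← this]
    ring
  rw [kernel, regularKernel, Finset.prod_congr rfl fun i _ => h1 i, Finset.prod_mul_distrib]
  have h2 : t ^ r * ∏ _i : Fin r, t⁻¹ = 1 := by
    rw [Finset.prod_const, Finset.card_univ, Fintype.card_fin, inv_pow,
      mul_inv_cancel₀ (pow_ne_zero _ ht)]
  rw [mul_left_comm, ← mul_assoc (t ^ r), h2, one_mul]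

theorem differentiable_dslope_one_sub_exp :
    Differentiable ℂ (dslope (fun u : ℂ => 1 - Complex.exp (Complex.I * u)) 0) := by
  rw [← differentiableOn_univ, Complex.differentiableOn_dslope univ_mem]
  exact Differentiable.differentiableOn (by fun_prop)

/-- The parameters `(z, ω)` in the upper half-plane. -/
def upperParams (r : ℕ) : Set (ℂ × (Fin r → ℂ)) := {p | 0 < p.1.im ∧ ∀ i, 0 < (p.2 i).im}

theorem isOpen_upperParams (r : ℕ) : IsOpen (upperParams r) := by
  simp only [upperParams, ofPred_and, ofPred_forall]
  exact (isOpen_lt (by fun_prop) (by fun_prop)).inter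
    (isOpen_iInter_of_finite fun i => isOpen_lt (by fun_prop) (by fun_prop))

/-- Uniform constants for all later estimates: b controls decay at infinity, while R and C control
the Taylor remainder at 0. The denominators stay away from 0 because 1 - e^{iu} has a simple zero at
u = 0. -/
theorem exists_nhds_regularKernel {r : ℕ} {p₀ : ℂ × (Fin r → ℂ)} (hp₀ : p₀ ∈ upperParams r) :
    ∃ W : Set (ℂ × (Fin r → ℂ)), IsOpen W ∧ p₀ ∈ W ∧ ∃ b > 0, ∃ R > 0, ∃ C > 0, R ≤ 1 ∧
      (∀ p ∈ W, b ≤ p.1.im ∧ ∀ i, b ≤ (p.2 i).im) ∧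
      (∀ p ∈ W, ∀ t ∈ closedBall (0 : ℂ) R, DifferentiableAt ℂ (fun q : ℂ × ℂ × (Fin r → ℂ) =>
        regularKernel q.1 q.2) (t, p)) ∧
      ∀ p ∈ W, ∀ t ∈ closedBall (0 : ℂ) R, ‖regularKernel t p‖ ≤ C := by
  set m := dslope (fun u : ℂ => 1 - Complex.exp (Complex.I * u)) 0 with hm
  have hmd : Differentiable ℂ m := differentiable_dslope_one_sub_exp
  have hm0 : m 0 ≠ 0 := by
    have : HasDerivAt (fun u : ℂ => 1 - Complex.exp (Complex.I * u))
        (-(Complex.exp (Complex.I * 0) * (Complex.I * 1))) 0 :=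
      (((hasDerivAt_id (0 : ℂ)).const_mul Complex.I).cexp).const_sub 1
    rw [hm, dslope_same, this.deriv]
    simp
  obtain ⟨η, hη, hmη⟩ := Metric.eventually_nhds_iff_ball.1
    (hmd.continuous.continuousAt.eventually_ne hm0)
  obtain ⟨ε, hε, hball⟩ := Metric.isOpen_iff.1 (isOpen_upperParams r) p₀ hp₀
  set K := closedBall p₀ (ε / 2)
  have hK : IsCompact K := isCompact_closedBall _ _
  have hKU : K ⊆ upperParams r := (closedBall_subset_ball (half_lt_self hε)).trans hball
  have hpK : p₀ ∈ K := mem_closedBall_self (by positivity)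
  obtain ⟨b, hb, hbK⟩ : ∃ b > 0, ∀ p ∈ K, b ≤ p.1.im ∧ ∀ i, b ≤ (p.2 i).im := by
    have h1 : ∀ f : ℂ × (Fin r → ℂ) → ℝ, Continuous f → (∀ p ∈ K, 0 < f p) →
        ∃ b > 0, ∀ p ∈ K, b ≤ f p := by
      intro f hf hf0
      obtain ⟨p, hp, hmin⟩ := hK.exists_isMinOn ⟨p₀, hpK⟩ hf.continuousOn
      exact ⟨f p, hf0 p hp, fun q hq => hmin hq⟩
    obtain ⟨b₀, hb₀, h2⟩ := h1 (fun p => p.1.im) (by fun_prop) fun p hp => (hKU hp).1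
    choose b hb h3 using fun i : Fin r =>
      h1 (fun p => (p.2 i).im) (by fun_prop) fun p hp => (hKU hp).2 i
    obtain ⟨b', hb', h4⟩ : ∃ b' > 0, ∀ i, b' ≤ b i := by
      rcases isEmpty_or_nonempty (Fin r) with h | h
      · exact ⟨1, one_pos, fun i => (h.false i).elim⟩
      · obtain ⟨i, hi⟩ := Finite.exists_min b
        exact ⟨_, hb i, hi⟩
    exact ⟨min b₀ b', lt_min hb₀ hb', fun p hp => ⟨(min_le_left _ _).trans (h2 p hp),
      fun i => (min_le_right _ _).trans ((h4 i).trans (h3 i p hp))⟩⟩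
  obtain ⟨M, hM⟩ := hK.isBounded.exists_norm_le
  have hM0 : 0 ≤ M := (norm_nonneg _).trans (hM p₀ hpK)
  -- M bounds the periods, so every ω_i t with |t| ≤ R falls in the disc where m has no zero. R ≤ 1
  -- later serves to compare powers of t on (0, R/2].
  obtain ⟨R, hR, hR1, hRM⟩ : ∃ R > 0, R ≤ 1 ∧ M * R < η := by
    refine ⟨min 1 (η / (M + 1)), by positivity, min_le_left _ _, ?_⟩
    calc M * min 1 (η / (M + 1)) ≤ M * (η / (M + 1)) := by gcongr; exact min_le_right _ _
      _ < η := by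
        rw [mul_div_assoc', div_lt_iff₀ (by positivity)]
        nlinarith
  have hne : ∀ p ∈ K, ∀ t ∈ closedBall (0 : ℂ) R, ∀ i, p.2 i * m (p.2 i * t) ≠ 0 := by
    intro p hp t ht i
    refine mul_ne_zero (fun h => ?_) (hmη _ ?_)
    · have := (hKU hp).2 i
      simp [h] at this
    · rw [mem_ball_zero_iff, norm_mul]
      rw [mem_closedBall_zero_iff] at ht
      refine lt_of_le_of_lt (mul_le_mul ?_ ht (norm_nonneg _) hM0) hRM
      exact ((norm_le_pi_norm p.2 i).trans (norm_snd_le p)).trans (hM p hp)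
  have hdiff : ∀ p ∈ K, ∀ t ∈ closedBall (0 : ℂ) R, DifferentiableAt ℂ
      (fun q : ℂ × ℂ × (Fin r → ℂ) => regularKernel q.1 q.2) (t, p) := by
    intro p hp t ht
    unfold regularKernel
    refine DifferentiableAt.mul (by fun_prop) ?_
    have h : ∀ i, DifferentiableAt ℂ (fun q : ℂ × ℂ × (Fin r → ℂ) =>
        (q.2.2 i * m (q.2.2 i * q.1))⁻¹) (t, p) := by
      intro i
      have h1 : DifferentiableAt ℂ (fun q : ℂ × ℂ × (Fin r → ℂ) => q.2.2 i) (t, p) := by fun_prop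
      have h2 : DifferentiableAt ℂ (fun q : ℂ × ℂ × (Fin r → ℂ) => m (q.2.2 i * q.1)) (t, p) :=
        DifferentiableAt.comp (t, p) (hmd _) (h1.mul (by fun_prop))
      exact (h1.mul h2).inv (hne p hp t ht i)
    exact (HasFDerivAt.finsetProd (u := Finset.univ)
      fun i _ => (h i).hasFDerivAt).differentiableAt
  obtain ⟨C, hC⟩ := ((isCompact_closedBall (0 : ℂ) R).prod hK).exists_bound_of_continuousOn
    (f := fun q : ℂ × ℂ × (Fin r → ℂ) => regularKernel q.1 q.2)
    fun q hq => (hdiff q.2 hq.2 q.1 hq.1).continuousAt.continuousWithinAt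
  have hWK : ball p₀ (ε / 2) ⊆ K := ball_subset_closedBall
  refine ⟨ball p₀ (ε / 2), isOpen_ball, mem_ball_self (by positivity), b, hb, R, hR, max C 1,
    by positivity, hR1, fun p hp => hbK p (hWK hp), fun p hp => hdiff p (hWK hp),
    fun p hp t ht => (hC (t, p) ⟨ht, hWK hp⟩).trans (le_max_left _ _)⟩

/-! ### Continuation in s, jointly holomorphic in the parameters -/

/-- The domain `{Re s > -1} ∖ {1, …, r}` of the continued Barnes zeta function. -/
def zetaDomain (r : ℕ) : Set ℂ := {s | -1 < s.re ∧ ∀ k ∈ Finset.Icc 1 r, s ≠ (k : ℂ)}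

theorem isOpen_zetaDomain (r : ℕ) : IsOpen (zetaDomain r) := by
  have : zetaDomain r = {s | -1 < s.re} ∩ ⋂ k ∈ Finset.Icc 1 r, {s : ℂ | s ≠ (k : ℂ)} := by
    ext s
    simp [zetaDomain]
  rw [this]
  exact (isOpen_lt continuous_const Complex.continuous_re).inter
    (isOpen_biInter_finset fun k _ => isOpen_ne)

theorem mem_zetaDomain_of_lt {r : ℕ} {s : ℂ} (hs : r < s.re) : s ∈ zetaDomain r := by
  refine ⟨by linarith [(Nat.cast_nonneg r : (0 : ℝ) ≤ r)], fun k hk h => ?_⟩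
  rw [h, Complex.natCast_re, Nat.cast_lt] at hs
  exact absurd (Finset.mem_Icc.1 hk).2 (not_le.2 hs)

section LocalContinuation

variable {r : ℕ} {W : Set (ℂ × (Fin r → ℂ))} {b R C : ℝ}

theorem continuousOn_kernel {p : ℂ × (Fin r → ℂ)} (hp : ∀ i, 0 < (p.2 i).im) :
    ContinuousOn (fun t : ℝ => kernel (t : ℂ) p) (Ioi 0) := by
  unfold kernel
  refine ContinuousOn.mul (by fun_prop) (continuousOn_finsetProd _ fun i _ =>
    ContinuousOn.inv₀ (by fun_prop) fun t ht h => ?_)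
  have := norm_exp_I_mul_lt_one (hp i) ht
  rw [← sub_eq_zero.1 h] at this
  simp at this

theorem differentiableAt_kernel {p : ℂ × (Fin r → ℂ)} (hp : ∀ i, 0 < (p.2 i).im) {t : ℝ}
    (ht : 0 < t) : DifferentiableAt ℂ (kernel (r := r) (t : ℂ)) p := by
  have h : ∀ i, DifferentiableAt ℂ (fun q : ℂ × (Fin r → ℂ) =>
      (1 - Complex.exp (Complex.I * q.2 i * t))⁻¹) p := by
    intro i
    have h1 : DifferentiableAt ℂ (fun q : ℂ × (Fin r → ℂ) =>
      1 - Complex.exp (Complex.I * q.2 i * t)) p := by fun_prop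
    refine h1.inv fun h => ?_
    have := norm_exp_I_mul_lt_one (hp i) ht
    rw [← sub_eq_zero.1 h] at this
    simp at this
  have h2 : DifferentiableAt ℂ (fun q : ℂ × (Fin r → ℂ) =>
      ∏ i, (1 - Complex.exp (Complex.I * q.2 i * t))⁻¹) p :=
    (HasFDerivAt.finsetProd (u := Finset.univ) fun i _ => (h i).hasFDerivAt).differentiableAt
  unfold kernel
  exact DifferentiableAt.mul (by fun_prop) h2

theorem differentiableAt_ofReal_cpow {r : ℕ} {t : ℝ} (ht : 0 < t) (c : ℂ)
    (q : ℂ × ℂ × (Fin r → ℂ)) :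
    DifferentiableAt ℂ (fun q : ℂ × ℂ × (Fin r → ℂ) => (t : ℂ) ^ (q.1 - c)) q :=
  DifferentiableAt.const_cpow (by fun_prop) (Or.inl (Complex.ofReal_ne_zero.2 ht.ne'))

theorem continuousOn_cpow (a : ℂ) : ContinuousOn (fun t : ℝ => (t : ℂ) ^ a) (Ioi 0) :=
  fun t ht => (Complex.continuousAt_ofReal_cpow_const t a
    (Or.inr (ne_of_gt ht))).continuousWithinAt

/-- A majorant independent of σ. For t ≤ 1 write t^{-N-1} = t^{-2N} t^{N-1} and use t > R. -/
theorem rpow_le_of_abs_lt {R σ N t : ℝ} (hR : 0 < R) (hN : 0 < N) (hσ : |σ| < N) (ht : R < t) :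
    t ^ (σ - 1) ≤ (1 + R ^ (-(2 * N))) * t ^ (N - 1) := by
  have ht0 : 0 < t := hR.trans ht
  obtain ⟨h1, h2⟩ := abs_lt.1 hσ
  have hR0 : 0 ≤ R ^ (-(2 * N)) := Real.rpow_nonneg hR.le _
  have ht1 : 0 ≤ t ^ (N - 1) := Real.rpow_nonneg ht0.le _
  rcases le_total 1 t with h | h
  · have : t ^ (σ - 1) ≤ t ^ (N - 1) := Real.rpow_le_rpow_of_exponent_le h (by linarith)
    nlinarith [mul_nonneg hR0 ht1]
  · have h3 : t ^ (σ - 1) ≤ t ^ (-(2 * N) + (N - 1)) :=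
      Real.rpow_le_rpow_of_exponent_ge ht0 h (by linarith)
    rw [Real.rpow_add ht0] at h3
    have h4 : t ^ (-(2 * N)) ≤ R ^ (-(2 * N)) :=
      Real.rpow_le_rpow_of_nonpos hR ht.le (by linarith)
    nlinarith [mul_le_mul_of_nonneg_right h4 ht1]

/-- The part of the Mellin transform away from `0` is jointly holomorphic. -/
theorem differentiableOn_integral_Ioi (hW : IsOpen W) (hb : 0 < b) (hR : 0 < R)
    (hWb : ∀ p ∈ W, b ≤ p.1.im ∧ ∀ i, b ≤ (p.2 i).im) :
    DifferentiableOn ℂ (fun q : ℂ × ℂ × (Fin r → ℂ) =>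
      ∫ t : ℝ in Ioi R, (t : ℂ) ^ (q.1 - 1) * kernel t q.2) (univ ×ˢ W) := by
  rintro ⟨s₀, p₀⟩ ⟨-, hp₀⟩
  obtain ⟨N, hN⟩ := exists_gt (max |s₀.re| r)
  have hNr : (r : ℝ) < N := (le_max_right _ _).trans_lt hN
  have hN0 : 0 < N := (Nat.cast_nonneg r).trans_lt hNr
  set U : Set (ℂ × ℂ × (Fin r → ℂ)) := {s : ℂ | |s.re| < N} ×ˢ W
  have hU : IsOpen U := (isOpen_lt (by fun_prop) (by fun_prop)).prod hW
  have hmem : (s₀, p₀) ∈ U := ⟨(le_max_left _ _).trans_lt hN, hp₀⟩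
  have hpos : ∀ p ∈ W, ∀ i, 0 < (p.2 i).im := fun p hp i => hb.trans_le ((hWb p hp).2 i)
  have hsub : Ioi R ⊆ Ioi 0 := Ioi_subset_Ioi hR.le
  refine ((differentiableOn_integral_of_norm_le (μ := volume.restrict (Ioi R))
    (F := fun (q : ℂ × ℂ × (Fin r → ℂ)) (t : ℝ) => (t : ℂ) ^ (q.1 - 1) * kernel t q.2)
    (bound := fun t => (1 + R ^ (-(2 * N))) * (t ^ (N - 1) * (Real.exp (-(b * t)) *
      (1 + (b * t)⁻¹) ^ r))) hU ?_ ?_ ?_ ?_) _ hmem).differentiableAt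
    (hU.mem_nhds hmem) |>.differentiableWithinAt
  · filter_upwards [self_mem_ae_restrict measurableSet_Ioi] with t ht q hq
    exact ((differentiableAt_ofReal_cpow (hsub ht) 1 q).mul
      (DifferentiableAt.comp q (differentiableAt_kernel (hpos q.2 hq.2) (hsub ht))
        differentiableAt_snd)).differentiableWithinAt
  · intro q hq
    exact (((continuousOn_cpow _).mul (continuousOn_kernel (hpos q.2 hq.2))).mono
      hsub).aestronglyMeasurable measurableSet_Ioi
  · filter_upwards [self_mem_ae_restrict measurableSet_Ioi] with t ht q hq
    have ht0 : 0 < t := hsub ht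
    rw [norm_mul, Complex.norm_cpow_eq_rpow_re_of_pos ht0, ← mul_assoc]
    refine mul_le_mul (rpow_le_of_abs_lt hR hN0 hq.1 ht)
      (norm_kernel_le hb (hWb q.2 hq.2).1 (hWb q.2 hq.2).2 ht0) (norm_nonneg _) ?_
    have := Real.rpow_nonneg hR.le (-(2 * N))
    have := Real.rpow_nonneg ht0.le (N - 1)
    positivity
  · exact ((integrableOn_majorant hb hb hNr).mono_set hsub).const_mul _

/-- The Taylor remainder of `regularKernel` at `t = 0`. -/
noncomputable def kernelRemainder (R : ℝ) (t : ℂ) (p : ℂ × (Fin r → ℂ)) : ℂ :=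
  regularKernel t p -
    ∑ k ∈ Finset.range (r + 1), taylorCoeff R (fun ξ => regularKernel ξ p) k * t ^ k

theorem differentiableOn_taylorCoeff_regularKernel (hW : IsOpen W) (hR : 0 < R)
    (hd : ∀ p ∈ W, ∀ t ∈ closedBall (0 : ℂ) R, DifferentiableAt ℂ
      (fun q : ℂ × ℂ × (Fin r → ℂ) => regularKernel q.1 q.2) (t, p))
    (hC : ∀ p ∈ W, ∀ t ∈ closedBall (0 : ℂ) R, ‖regularKernel t p‖ ≤ C) (k : ℕ) :
    DifferentiableOn ℂ (fun p : ℂ × (Fin r → ℂ) =>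
      taylorCoeff R (fun ξ => regularKernel ξ p) k) W := by
  refine differentiableOn_taylorCoeff hW hR (fun p hp t ht => ?_) (fun t ht p hp => ?_)
    (fun p hp t ht => hC p hp t (sphere_subset_closedBall ht)) k
  · exact ((hd p hp t (sphere_subset_closedBall ht)).continuousAt.comp
      (f := fun t : ℂ => (t, p)) (by fun_prop)).continuousWithinAt
  · exact (DifferentiableAt.comp p (f := fun p => (t, p))
      (hd p hp t (sphere_subset_closedBall ht)) (by fun_prop)).differentiableWithinAt

theorem norm_kernelRemainder_le (hR : 0 < R) {p : ℂ × (Fin r → ℂ)}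
    (hd : ∀ t ∈ closedBall (0 : ℂ) R, DifferentiableAt ℂ
      (fun q : ℂ × ℂ × (Fin r → ℂ) => regularKernel q.1 q.2) (t, p))
    (hC : ∀ t ∈ closedBall (0 : ℂ) R, ‖regularKernel t p‖ ≤ C) {t : ℝ} (ht : 0 < t)
    (htR : t ≤ R / 2) :
    ‖kernelRemainder R (t : ℂ) p‖ ≤ 2 * C / R ^ (r + 1) * t ^ (r + 1) := by
  have hn : ‖(t : ℂ)‖ = t := by rw [Complex.norm_real, Real.norm_of_nonneg ht.le]
  have := norm_sub_sum_taylorCoeff_le hR (f := fun ξ => regularKernel ξ p) (fun t ht =>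
    (DifferentiableAt.comp t (f := fun t : ℂ => (t, p)) (hd t ht)
      (by fun_prop)).differentiableWithinAt) hC (r + 1) (t := t) (by rwa [hn])
  rwa [hn] at this

theorem continuousOn_kernelRemainder (hR : 0 < R) {p : ℂ × (Fin r → ℂ)}
    (hd : ∀ t ∈ closedBall (0 : ℂ) R, DifferentiableAt ℂ
      (fun q : ℂ × ℂ × (Fin r → ℂ) => regularKernel q.1 q.2) (t, p)) :
    ContinuousOn (fun t : ℝ => kernelRemainder R (t : ℂ) p) (Ioc 0 (R / 2)) := by
  refine ContinuousOn.sub (fun t ht => ?_) (by fun_prop)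
  have h1 : (t : ℂ) ∈ closedBall (0 : ℂ) R := by
    rw [mem_closedBall_zero_iff, Complex.norm_real, Real.norm_of_nonneg ht.1.le]
    linarith [ht.2]
  exact ((hd t h1).continuousAt.comp (f := fun t : ℝ => ((t : ℂ), p))
    (by fun_prop)).continuousWithinAt

theorem differentiableOn_integral_Ioc (hW : IsOpen W) (hR : 0 < R) (hR1 : R ≤ 1) (hC0 : 0 < C)
    (hd : ∀ p ∈ W, ∀ t ∈ closedBall (0 : ℂ) R, DifferentiableAt ℂ
      (fun q : ℂ × ℂ × (Fin r → ℂ) => regularKernel q.1 q.2) (t, p))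
    (hC : ∀ p ∈ W, ∀ t ∈ closedBall (0 : ℂ) R, ‖regularKernel t p‖ ≤ C) :
    DifferentiableOn ℂ (fun q : ℂ × ℂ × (Fin r → ℂ) =>
      ∫ t : ℝ in Ioc 0 (R / 2), (t : ℂ) ^ (q.1 - (r + 1 : ℕ)) * kernelRemainder R t q.2)
      ({s : ℂ | -1 < s.re} ×ˢ W) := by
  rintro ⟨s₀, p₀⟩ ⟨hs₀, hp₀⟩
  -- The remainder is O(t^{r+1}), so the integrand is O(t^a) uniformly for Re s > a, and a > -1
  -- makes this integrable at 0.
  obtain ⟨a, ha, has⟩ := exists_between (show -1 < s₀.re from hs₀)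
  set U : Set (ℂ × ℂ × (Fin r → ℂ)) := {s : ℂ | a < s.re} ×ˢ W
  have hU : IsOpen U := (isOpen_lt (by fun_prop) (by fun_prop)).prod hW
  have hmem : (s₀, p₀) ∈ U := ⟨has, hp₀⟩
  have hsub : Ioc 0 (R / 2) ⊆ Ioi 0 := fun t ht => ht.1
  have hcl : ∀ t ∈ Ioc 0 (R / 2), (t : ℂ) ∈ closedBall (0 : ℂ) R := fun t ht => by
    rw [mem_closedBall_zero_iff, Complex.norm_real, Real.norm_of_nonneg ht.1.le]
    linarith [ht.2]
  refine ((differentiableOn_integral_of_norm_le (μ := volume.restrict (Ioc 0 (R / 2)))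
    (F := fun (q : ℂ × ℂ × (Fin r → ℂ)) (t : ℝ) =>
      (t : ℂ) ^ (q.1 - (r + 1 : ℕ)) * kernelRemainder R t q.2)
    (bound := fun t => 2 * C / R ^ (r + 1) * t ^ a) hU ?_ ?_ ?_ ?_) _ hmem).differentiableAt
    (hU.mem_nhds hmem) |>.differentiableWithinAt
  · filter_upwards [self_mem_ae_restrict measurableSet_Ioc] with t ht
    refine DifferentiableOn.mul
      (fun q _ => (differentiableAt_ofReal_cpow ht.1 _ q).differentiableWithinAt) ?_
    have h1 : DifferentiableOn ℂ (kernelRemainder R (t : ℂ)) W := by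
      refine DifferentiableOn.sub (fun p hp => ?_) (DifferentiableOn.fun_sum fun k _ =>
        (differentiableOn_taylorCoeff_regularKernel hW hR hd hC k).mul_const _)
      exact (DifferentiableAt.comp p (f := fun p => ((t : ℂ), p)) (hd p hp t (hcl t ht))
        (by fun_prop)).differentiableWithinAt
    exact h1.comp differentiableOn_snd fun q hq => hq.2
  · intro q hq
    exact ContinuousOn.aestronglyMeasurable (((continuousOn_cpow _).mono hsub).mul
      (continuousOn_kernelRemainder hR (hd q.2 hq.2))) measurableSet_Ioc
  · filter_upwards [self_mem_ae_restrict measurableSet_Ioc] with t ht q hq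
    have h1 := norm_kernelRemainder_le hR (hd q.2 hq.2) (hC q.2 hq.2) ht.1 ht.2
    have h2 : t ^ (q.1.re - (r + 1 : ℕ)) * t ^ (r + 1) = t ^ q.1.re := by
      rw [← Real.rpow_natCast, ← Real.rpow_add ht.1, sub_add_cancel]
    have h3 : t ^ q.1.re ≤ t ^ a :=
      Real.rpow_le_rpow_of_exponent_ge ht.1 (by linarith [ht.2]) (le_of_lt hq.1)
    rw [norm_mul, Complex.norm_cpow_eq_rpow_re_of_pos ht.1, Complex.sub_re, Complex.natCast_re]
    calc t ^ (q.1.re - (r + 1 : ℕ)) * ‖kernelRemainder R (t : ℂ) q.2‖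
        ≤ t ^ (q.1.re - (r + 1 : ℕ)) * (2 * C / R ^ (r + 1) * t ^ (r + 1)) :=
          mul_le_mul_of_nonneg_left h1 (Real.rpow_nonneg ht.1.le _)
      _ = 2 * C / R ^ (r + 1) * t ^ q.1.re := by rw [mul_left_comm, h2]
      _ ≤ 2 * C / R ^ (r + 1) * t ^ a := by gcongr
  · exact ((intervalIntegral.intervalIntegrable_rpow' ha (a := 0) (b := R / 2)).1).const_mul _

/-- The continuation of the Barnes zeta function for parameters in the upper half-plane. -/
noncomputable def continuedZeta (R : ℝ) (s : ℂ) (p : ℂ × (Fin r → ℂ)) : ℂ :=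
  Complex.exp (-(π * Complex.I / 2 * s)) * ((Complex.Gamma s)⁻¹ *
      ((∫ t : ℝ in Ioi (R / 2), (t : ℂ) ^ (s - 1) * kernel t p) +
        (∫ t : ℝ in Ioc 0 (R / 2), (t : ℂ) ^ (s - (r + 1 : ℕ)) * kernelRemainder R t p) +
        ∑ k ∈ Finset.range r, taylorCoeff R (fun ξ => regularKernel ξ p) k *
          (((R / 2 : ℝ) : ℂ) ^ (s - (r - k : ℕ)) / (s - (r - k : ℕ)))) +
    taylorCoeff R (fun ξ => regularKernel ξ p) r *
      ((R / 2 : ℝ) : ℂ) ^ s * (Complex.Gamma (s + 1))⁻¹)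

/-- The Taylor term of order k integrates over (0, R/2] to (R/2)^{s-(r-k)}/(s-(r-k)). For k < r its
pole r - k is excluded from the domain. For k = r the pole at 0 cancels against 1/Γ(s), since sΓ(s)
= Γ(s+1); hence the separate last term of `continuedZeta`. -/
theorem differentiableOn_continuedZeta (hW : IsOpen W) (hb : 0 < b) (hR : 0 < R) (hR1 : R ≤ 1)
    (hC0 : 0 < C) (hWb : ∀ p ∈ W, b ≤ p.1.im ∧ ∀ i, b ≤ (p.2 i).im)
    (hd : ∀ p ∈ W, ∀ t ∈ closedBall (0 : ℂ) R, DifferentiableAt ℂ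
      (fun q : ℂ × ℂ × (Fin r → ℂ) => regularKernel q.1 q.2) (t, p))
    (hC : ∀ p ∈ W, ∀ t ∈ closedBall (0 : ℂ) R, ‖regularKernel t p‖ ≤ C) :
    DifferentiableOn ℂ (fun q : ℂ × ℂ × (Fin r → ℂ) => continuedZeta R q.1 q.2)
      (zetaDomain r ×ˢ W) := by
  have hR2 : 0 < R / 2 := half_pos hR
  have hΓ : Differentiable ℂ fun q : ℂ × ℂ × (Fin r → ℂ) => (Complex.Gamma q.1)⁻¹ :=
    Complex.differentiable_one_div_Gamma.comp differentiable_fst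
  have hΓ1 : Differentiable ℂ fun q : ℂ × ℂ × (Fin r → ℂ) => (Complex.Gamma (q.1 + 1))⁻¹ :=
    Complex.differentiable_one_div_Gamma.comp (differentiable_fst.add_const 1)
  have hc : ∀ k, DifferentiableOn ℂ (fun q : ℂ × ℂ × (Fin r → ℂ) =>
      taylorCoeff R (fun ξ => regularKernel ξ q.2) k) (zetaDomain r ×ˢ W) := fun k =>
    (differentiableOn_taylorCoeff_regularKernel hW hR hd hC k).comp differentiableOn_snd
      fun q hq => hq.2
  have hcpow : ∀ c : ℂ, DifferentiableOn ℂ (fun q : ℂ × ℂ × (Fin r → ℂ) =>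
      ((R / 2 : ℝ) : ℂ) ^ (q.1 - c)) (zetaDomain r ×ˢ W) := fun c q _ =>
    (differentiableAt_ofReal_cpow hR2 c q).differentiableWithinAt
  have hsub : ∀ c : ℂ, DifferentiableOn ℂ (fun q : ℂ × ℂ × (Fin r → ℂ) => q.1 - c)
      (zetaDomain r ×ˢ W) := fun c => differentiableOn_fst.sub_const c
  simp only [continuedZeta]
  refine DifferentiableOn.mul (Differentiable.differentiableOn (by fun_prop))
    (DifferentiableOn.add (hΓ.differentiableOn.mul (DifferentiableOn.add (DifferentiableOn.add
      ((differentiableOn_integral_Ioi hW hb hR2 hWb).mono fun q hq => ⟨trivial, hq.2⟩)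
      ((differentiableOn_integral_Ioc hW hR hR1 hC0 hd hC).mono fun q hq => ⟨hq.1.1, hq.2⟩))
      (DifferentiableOn.fun_sum fun k hk => (hc k).mul
        ((hcpow _).mul (DifferentiableOn.inv (hsub _) ?_))))) ?_)
  · intro q hq
    have hk := Finset.mem_range.1 hk
    exact sub_ne_zero.2 (hq.1.2 (r - k) (Finset.mem_Icc.2 ⟨by omega, by omega⟩))
  · refine ((hc r).mul ?_).mul hΓ1.differentiableOn
    simpa using hcpow 0

/-- For Re s > r the Taylor terms are integrable on (0, R/2], so the polynomial subtracted in the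
remainder can be added back in closed form. -/
theorem continuedZeta_eq (hb : 0 < b) (hR : 0 < R) {p : ℂ × (Fin r → ℂ)}
    (hpb : b ≤ p.1.im ∧ ∀ i, b ≤ (p.2 i).im)
    {s : ℂ} (hs : r < s.re) :
    continuedZeta R s p = Complex.exp (-(π * Complex.I / 2 * s)) * (Complex.Gamma s)⁻¹ *
        ∫ t : ℝ in Ioi 0, (t : ℂ) ^ (s - 1) * kernel t p := by
  have hR2 : 0 < R / 2 := half_pos hR
  have hpos : ∀ i, 0 < (p.2 i).im := fun i => hb.trans_le (hpb.2 i)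
  have hs0 : 0 < s.re := (Nat.cast_nonneg r).trans_lt hs
  have hsne : s ≠ 0 := by rintro rfl; simp at hs0
  set c := taylorCoeff R (fun ξ => regularKernel ξ p) with hc
  have hint : IntegrableOn (fun t : ℝ => (t : ℂ) ^ (s - 1) * kernel t p) (Ioi 0) := by
    refine (integrableOn_majorant hb hb hs).mono' (((continuousOn_cpow _).mul
      (continuousOn_kernel hpos)).aestronglyMeasurable measurableSet_Ioi) ?_
    filter_upwards [self_mem_ae_restrict measurableSet_Ioi] with t ht
    rw [norm_mul, Complex.norm_cpow_eq_rpow_re_of_pos ht]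
    exact mul_le_mul_of_nonneg_left (norm_kernel_le hb hpb.1 hpb.2 ht)
      (Real.rpow_nonneg (le_of_lt ht) _)
  have hre : ∀ k ≤ r, -1 < (s - (r + 1 - k : ℕ)).re := fun k hk => by
    rw [Complex.sub_re, Complex.natCast_re, Nat.cast_sub (by omega)]
    push_cast
    linarith [(Nat.cast_nonneg k : (0 : ℝ) ≤ k)]
  have hterm : ∀ k ≤ r, IntegrableOn (fun t : ℝ => c k * (t : ℂ) ^ (s - (r + 1 - k : ℕ)))
      (Ioc 0 (R / 2)) := fun k hk =>
    ((intervalIntegral.intervalIntegrable_cpow' (hre k hk) (a := 0) (b := R / 2)).1).const_mul _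
  have hval : ∀ k ≤ r, ∫ t : ℝ in Ioc 0 (R / 2), c k * (t : ℂ) ^ (s - (r + 1 - k : ℕ)) =
      c k * (((R / 2 : ℝ) : ℂ) ^ (s - (r - k : ℕ)) / (s - (r - k : ℕ))) := by
    intro k hk
    have h1 : s - (r + 1 - k : ℕ) + 1 = s - (r - k : ℕ) := by
      rw [Nat.cast_sub (by omega), Nat.cast_sub hk]
      push_cast
      ring
    have h2 : s - (r - k : ℕ) ≠ 0 := by
      intro h
      have := hre k hk
      rw [eq_sub_of_add_eq h1, h] at this
      simp at this
    rw [integral_const_mul, ← intervalIntegral.integral_of_le hR2.le,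
      integral_cpow (Or.inl (hre k hk)), h1, Complex.ofReal_zero, Complex.zero_cpow h2, sub_zero]
  have hsplit : ∀ t ∈ Ioc 0 (R / 2), (t : ℂ) ^ (s - (r + 1 : ℕ)) * kernelRemainder R t p =
      (t : ℂ) ^ (s - 1) * kernel t p -
        ∑ k ∈ Finset.range (r + 1), c k * (t : ℂ) ^ (s - (r + 1 - k : ℕ)) := by
    intro t ht
    have ht0 : (t : ℂ) ≠ 0 := Complex.ofReal_ne_zero.2 ht.1.ne'
    rw [kernelRemainder, ← pow_mul_kernel ht0, mul_sub, Finset.mul_sum, ← mul_assoc,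
      ← Complex.cpow_natCast, ← Complex.cpow_add _ _ ht0]
    congr 1
    · congr 2
      push_cast
      ring
    · refine Finset.sum_congr rfl fun k hk => ?_
      have hk : k < r + 1 := Finset.mem_range.1 hk
      rw [mul_left_comm, ← Complex.cpow_natCast, ← Complex.cpow_add _ _ ht0, ← hc]
      congr 2
      rw [Nat.cast_sub hk.le]
      ring
  have hsmall : ∫ t : ℝ in Ioc 0 (R / 2), (t : ℂ) ^ (s - (r + 1 : ℕ)) * kernelRemainder R t p =
      (∫ t : ℝ in Ioc 0 (R / 2), (t : ℂ) ^ (s - 1) * kernel t p) -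
        ∑ k ∈ Finset.range (r + 1),
          c k * (((R / 2 : ℝ) : ℂ) ^ (s - (r - k : ℕ)) / (s - (r - k : ℕ))) := by
    rw [setIntegral_congr_fun measurableSet_Ioc hsplit, integral_sub
      (hint.mono_set fun t ht => ht.1) (integrable_finsetSum _ fun k hk =>
        hterm k (Nat.lt_succ_iff.1 (Finset.mem_range.1 hk))), integral_finsetSum _ fun k hk =>
        hterm k (Nat.lt_succ_iff.1 (Finset.mem_range.1 hk))]
    congr 1
    exact Finset.sum_congr rfl fun k hk => hval k (Nat.lt_succ_iff.1 (Finset.mem_range.1 hk))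
  have hunion : ∫ t : ℝ in Ioi 0, (t : ℂ) ^ (s - 1) * kernel t p =
      (∫ t : ℝ in Ioc 0 (R / 2), (t : ℂ) ^ (s - 1) * kernel t p) +
        ∫ t : ℝ in Ioi (R / 2), (t : ℂ) ^ (s - 1) * kernel t p := by
    rw [← Ioc_union_Ioi_eq_Ioi hR2.le, setIntegral_union (Ioc_disjoint_Ioi le_rfl)
      measurableSet_Ioi (hint.mono_set fun t ht => ht.1)
      (hint.mono_set (Ioi_subset_Ioi hR2.le))]
  have hΓ := Complex.Gamma_ne_zero_of_re_pos hs0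
  rw [continuedZeta, hsmall, hunion, Finset.sum_range_succ, ← hc, Complex.Gamma_add_one s hsne]
  simp only [Nat.sub_self, Nat.cast_zero, sub_zero]
  field_simp
  ring

end LocalContinuation

/-- Near every point of the upper half-plane the continued Barnes zeta function is jointly
holomorphic in all its variables. -/
theorem exists_nhds_isBarnesZeta {r : ℕ} {p₀ : ℂ × (Fin r → ℂ)} (hp₀ : p₀ ∈ upperParams r) :
    ∃ W : Set (ℂ × (Fin r → ℂ)), IsOpen W ∧ p₀ ∈ W ∧ W ⊆ upperParams r ∧
      ∃ Z : ℂ → ℂ × (Fin r → ℂ) → ℂ,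
      DifferentiableOn ℂ (fun q : ℂ × ℂ × (Fin r → ℂ) => Z q.1 q.2) (zetaDomain r ×ˢ W) ∧
      (∀ p ∈ W, IsBarnesZeta p.2 p.1 fun s => Z s p) ∧
      ∀ p ∈ W, ∀ s : ℂ, r < s.re → Z s p =
        Complex.exp (-(π * Complex.I / 2 * s)) * (Complex.Gamma s)⁻¹ *
          ∫ t : ℝ in Ioi 0, (t : ℂ) ^ (s - 1) * kernel t p := by
  obtain ⟨W, hW, hpW, b, hb, R, hR, C, hC0, hR1, hWb, hd, hC⟩ := exists_nhds_regularKernel hp₀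
  have hsub : W ⊆ upperParams r := fun p hp =>
    ⟨hb.trans_le (hWb p hp).1, fun i => hb.trans_le ((hWb p hp).2 i)⟩
  have hdiff := differentiableOn_continuedZeta hW hb hR hR1 hC0 hWb hd hC
  have heq : ∀ p ∈ W, ∀ s : ℂ, r < s.re → continuedZeta R s p = _ :=
    fun p hp s hs => continuedZeta_eq hb hR (hWb p hp) hs
  refine ⟨W, hW, hpW, hsub, continuedZeta R, hdiff, fun p hp => ⟨?_, fun s hs => ?_⟩, heq⟩
  · exact hdiff.comp (f := fun s : ℂ => (s, p)) (Differentiable.differentiableOn (by fun_prop))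
      fun s hs => ⟨hs, hp⟩
  · simp only [heq p hp s hs]
    exact hasSum_barnesZeta_integral (hsub hp).1 (hsub hp).2 hs

/-! ### Interchange of derivatives -/

section SecondDerivative

variable {E : Type*} [NormedAddCommGroup E] [NormedSpace ℂ E] [FiniteDimensional ℂ E]

theorem differentiableOn_fderiv {f : E → ℂ} {U : Set E} (hU : IsOpen U)
    (hf : DifferentiableOn ℂ f U) : DifferentiableOn ℂ (fderiv ℂ f) U := by
  let b := Module.finBasis ℂ E
  have : fderiv ℂ f = fun x =>
      ∑ i, (fderiv ℂ f x (b i)) • LinearMap.toContinuousLinearMap (b.coord i) := by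
    funext x
    ext v
    conv_lhs => rw [← b.sum_repr v, map_sum]
    simp [mul_comm]
  rw [this]
  exact DifferentiableOn.fun_sum fun i _ =>
    (differentiableOn_fderiv_apply hU hf (b i)).smul_const _

/-- Used to exchange ∂_s at s = 0 with derivatives in (z, ω). -/
theorem fderiv_fderiv_apply_comm {f : E → ℂ} {U : Set E} (hU : IsOpen U)
    (hf : DifferentiableOn ℂ f U) {x : E} (hx : x ∈ U) (v w : E) :
    fderiv ℂ (fun y => fderiv ℂ f y v) x w = fderiv ℂ (fun y => fderiv ℂ f y w) x v := by
  have h1 : ∀ᶠ y in 𝓝 x, HasFDerivAt f (fderiv ℂ f y) y := by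
    filter_upwards [hU.mem_nhds hx] with y hy
    exact ((hf y hy).differentiableAt (hU.mem_nhds hy)).hasFDerivAt
  have h2 := ((differentiableOn_fderiv hU hf x hx).differentiableAt (hU.mem_nhds hx)).hasFDerivAt
  have h3 : ∀ u u' : E, fderiv ℂ (fun y => fderiv ℂ f y u) x u' =
      fderiv ℂ (fderiv ℂ f) x u' u := fun u u' => by
    have := ((ContinuousLinearMap.apply ℂ ℂ u).hasFDerivAt.comp x h2).fderiv
    simpa [Function.comp_def] using congrArg (fun L => L u') this
  rw [h3, h3]
  exact second_derivative_symmetric_of_eventually h1 h2 w v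

end SecondDerivative

/-! ### The function 1/Γ_r: zeros, ladder relation, holomorphy -/

theorem IsBarnesZeta.differentiableAt_zero {r : ℕ} {ω : Fin r → ℂ} {z : ℂ} {Z : ℂ → ℂ}
    (hZ : IsBarnesZeta ω z Z) : DifferentiableAt ℂ Z 0 := by
  have h0 : (0 : ℂ) ∈ zetaDomain r := ⟨by simp, fun k hk h => by
    have := (Finset.mem_Icc.1 hk).1
    rw [eq_comm, Nat.cast_eq_zero] at h
    omega⟩
  exact (hZ.1 0 h0).differentiableAt ((isOpen_zetaDomain r).mem_nhds h0)

/-- Makes Γ_r computable from any continuation, whichever one `Classical.epsilon` picks. -/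
theorem IsBarnesZeta.deriv_eq {r : ℕ} {ω : Fin r → ℂ} {z : ℂ} {Z W : ℂ → ℂ}
    (hZ : IsBarnesZeta ω z Z) (hW : IsBarnesZeta ω z W) : deriv Z 0 = deriv W 0 :=
  Filter.EventuallyEq.deriv_eq
    ((hZ.eqOn_ball hW).eventuallyEq_of_mem (ball_mem_nhds 0 one_pos))

/-- The entire function `1 / Γ_r`, as a function of `p = (z, ω)`. -/
noncomputable def invGamma {r : ℕ} (p : ℂ × (Fin r → ℂ)) : ℂ := (multipleGamma p.2 p.1)⁻¹

theorem invGamma_eq_zero_iff {r : ℕ} {p : ℂ × (Fin r → ℂ)} :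
    invGamma p = 0 ↔ ∃ n : Fin r → ℕ, p.1 + dot n p.2 = 0 := by
  rw [invGamma, inv_eq_zero, multipleGamma]
  split_ifs with h
  · simpa using h
  · simpa [Complex.exp_ne_zero] using h

theorem IsBarnesZeta.invGamma_eq {r : ℕ} {p : ℂ × (Fin r → ℂ)} {Z : ℂ → ℂ}
    (hZ : IsBarnesZeta p.2 p.1 Z) (hp : ¬∃ n : Fin r → ℕ, p.1 + dot n p.2 = 0) :
    invGamma p = Complex.exp (-deriv Z 0) := by
  have h : IsBarnesZeta p.2 p.1 (barnesZeta p.2 p.1) :=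
    Classical.epsilon_spec (p := IsBarnesZeta p.2 p.1) ⟨Z, hZ⟩
  rw [invGamma, multipleGamma, if_neg hp, Complex.exp_neg, h.deriv_eq hZ]

theorem dot_zero {r : ℕ} (ω : Fin r → ℂ) : dot 0 ω = 0 := by simp [dot]

theorem dot_cons {r : ℕ} (k : ℕ) (m : Fin r → ℕ) (ω : Fin (r + 1) → ℂ) :
    dot (Fin.cons k m : Fin (r + 1) → ℕ) ω = k * ω 0 + dot m (Fin.tail ω) := by
  simp [dot, Fin.sum_univ_succ, Fin.tail]

theorem hasSum_fin_succ {r : ℕ} {f : (Fin (r + 1) → ℕ) → ℂ} {a b : ℂ}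
    (ha : HasSum (fun m : Fin r → ℕ => f (Fin.cons 0 m)) a)
    (hb : HasSum (fun n : Fin (r + 1) → ℕ => f (Fin.cons (n 0 + 1) (Fin.tail n))) b) :
    HasSum f (a + b) := by
  set i₁ : (Fin r → ℕ) → Fin (r + 1) → ℕ := fun m => Fin.cons 0 m
  set i₂ : (Fin (r + 1) → ℕ) → Fin (r + 1) → ℕ := fun n => Fin.cons (n 0 + 1) (Fin.tail n)
  have hi₁ : Function.Injective i₁ := Fin.cons_right_injective (α := fun _ => ℕ) 0
  have hi₂ : Function.Injective i₂ := by
    intro n n' h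
    have h0 := congrFun h 0
    simp only [i₂, Fin.cons_zero, Nat.add_right_cancel_iff] at h0
    have h1 := congrArg Fin.tail h
    simp only [i₂, Fin.tail_cons] at h1
    rw [← Fin.cons_self_tail n, ← Fin.cons_self_tail n', h0, h1]
  have hc : IsCompl (range i₁) (range i₂) := by
    refine isCompl_iff.2 ⟨disjoint_iff_forall_ne.2 ?_, codisjoint_iff.2 (eq_univ_iff_forall.2 ?_)⟩
    · rintro _ ⟨m, rfl⟩ _ ⟨n, rfl⟩ h
      have := congrFun h 0
      simp only [i₁, i₂, Fin.cons_zero] at this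
      omega
    · intro n
      rcases Nat.eq_zero_or_eq_succ_pred (n 0) with h | h
      · refine Or.inl ⟨Fin.tail n, ?_⟩
        change Fin.cons 0 (Fin.tail n) = n
        rw [← h, Fin.cons_self_tail]
      · refine Or.inr ⟨Fin.cons (n 0 - 1) (Fin.tail n), ?_⟩
        change Fin.cons (n 0 - 1 + 1) (Fin.tail n) = n
        rw [Nat.sub_add_cancel (by omega), Fin.cons_self_tail]
  exact HasSum.add_isCompl hc (hi₁.hasSum_range_iff.2 ha) (hi₂.hasSum_range_iff.2 hb)

/-- Terms with n 0 = 0 form the series over the remaining periods; those with n 0 ≥ 1 form the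
series at z + ω 0. -/
theorem IsBarnesZeta.succ {r : ℕ} {ω : Fin (r + 1) → ℂ} {z : ℂ} {Z₁ Z₂ : ℂ → ℂ}
    (h₁ : IsBarnesZeta (Fin.tail ω) z Z₁) (h₂ : IsBarnesZeta ω (z + ω 0) Z₂) :
    IsBarnesZeta ω z (fun s => Z₁ s + Z₂ s) := by
  have hsub : zetaDomain (r + 1) ⊆ zetaDomain r := fun s hs =>
    ⟨hs.1, fun k hk => hs.2 k (Finset.Icc_subset_Icc_right (Nat.le_succ r) hk)⟩
  refine ⟨(h₁.1.mono hsub).add h₂.1, fun s hs => ?_⟩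
  have hs' : (r : ℝ) < s.re := lt_trans (by simp) hs
  have e₁ : ∀ m : Fin r → ℕ, z + dot (Fin.cons 0 m : Fin (r + 1) → ℕ) ω =
      z + dot m (Fin.tail ω) := fun m => by rw [dot_cons]; simp
  have e₂ : ∀ n : Fin (r + 1) → ℕ, z + dot (Fin.cons (n 0 + 1) (Fin.tail n) : Fin (r + 1) → ℕ) ω =
      z + ω 0 + dot n ω := fun n => by
    conv_rhs => rw [← Fin.cons_self_tail n, dot_cons]
    rw [dot_cons]
    push_cast
    ring
  refine hasSum_fin_succ ?_ ?_
  · simp only [e₁]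
    exact h₁.2 s hs'
  · simp only [e₂]
    exact h₂.2 s hs

theorem isBarnesZeta_zero (ω : Fin 0 → ℂ) {z : ℂ} (hz : z ≠ 0) :
    IsBarnesZeta ω z fun s => z ^ (-s) := by
  refine ⟨Differentiable.differentiableOn fun s =>
    DifferentiableAt.const_cpow (by fun_prop) (Or.inl hz), fun s _ => ?_⟩
  simp [dot]

theorem isBarnesZeta_zero_zero (ω : Fin 0 → ℂ) : IsBarnesZeta ω 0 fun _ => 0 := by
  refine ⟨differentiableOn_const 0, fun s hs => ?_⟩
  have hs0 : s ≠ 0 := by rintro rfl; simp at hs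
  simp [dot, Complex.zero_cpow (neg_ne_zero.2 hs0)]

theorem exists_nat_im_pos (z : ℂ) {w : ℂ} (hw : 0 < w.im) : ∃ N : ℕ, 0 < (z + N * w).im := by
  obtain ⟨N, hN⟩ := exists_nat_gt (-z.im / w.im)
  refine ⟨N, ?_⟩
  rw [div_lt_iff₀ hw] at hN
  simp
  linarith

/-- Induction on r and, inside it, on the number N of shifts by ω 0 that bring z into the upper
half-plane, where the Mellin transform applies. -/
theorem exists_isBarnesZeta {r : ℕ} {ω : Fin r → ℂ} (hω : ∀ i, 0 < (ω i).im) (z : ℂ) :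
    ∃ Z, IsBarnesZeta ω z Z := by
  induction r generalizing z with
  | zero =>
    rcases eq_or_ne z 0 with rfl | hz
    · exact ⟨_, isBarnesZeta_zero_zero ω⟩
    · exact ⟨_, isBarnesZeta_zero ω hz⟩
  | succ r ihr =>
    obtain ⟨N, hN⟩ := exists_nat_im_pos z (hω 0)
    induction N generalizing z with
    | zero =>
      have hmem : (z, ω) ∈ upperParams (r + 1) := ⟨by simpa using hN, hω⟩
      obtain ⟨W, -, hpW, -, Z, -, hZ, -⟩ := exists_nhds_isBarnesZeta hmem
      exact ⟨fun s => Z s (z, ω), hZ (z, ω) hpW⟩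
    | succ N ih =>
      obtain ⟨Z₁, h₁⟩ := ihr (ω := Fin.tail ω) (fun i => hω i.succ) z
      have hz : z + ω 0 + N * ω 0 = z + (N + 1 : ℕ) * ω 0 := by push_cast; ring
      obtain ⟨Z₂, h₂⟩ := ih (z + ω 0) (hz ▸ hN)
      exact ⟨_, h₁.succ h₂⟩

/-- Away from the zeros this is the exponential of `IsBarnesZeta.succ`. At the zeros both sides
vanish, since the index set splits in the same way. -/
theorem invGamma_succ {r : ℕ} {p : ℂ × (Fin (r + 1) → ℂ)} (hp : ∀ i, 0 < (p.2 i).im) :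
    invGamma p = invGamma (p.1, Fin.tail p.2) * invGamma (p.1 + p.2 0, p.2) := by
  have hiff : (∃ n : Fin (r + 1) → ℕ, p.1 + dot n p.2 = 0) ↔
      (∃ n : Fin r → ℕ, p.1 + dot n (Fin.tail p.2) = 0) ∨
        ∃ n : Fin (r + 1) → ℕ, p.1 + p.2 0 + dot n p.2 = 0 := by
    constructor
    · rintro ⟨n, hn⟩
      rw [← Fin.cons_self_tail n, dot_cons] at hn
      rcases Nat.eq_zero_or_eq_succ_pred (n 0) with h | h
      · exact Or.inl ⟨Fin.tail n, by simpa [h] using hn⟩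
      · refine Or.inr ⟨Fin.cons (n 0 - 1) (Fin.tail n), ?_⟩
        rw [dot_cons, ← hn, Nat.cast_sub (by omega)]
        push_cast
        ring
    · rintro (⟨m, hm⟩ | ⟨n, hn⟩)
      · exact ⟨Fin.cons 0 m, by rw [dot_cons, ← hm]; simp⟩
      · refine ⟨Fin.cons (n 0 + 1) (Fin.tail n), ?_⟩
        rw [← Fin.cons_self_tail n, dot_cons] at hn
        rw [dot_cons, ← hn]
        push_cast
        ring
  by_cases h : ∃ n : Fin (r + 1) → ℕ, p.1 + dot n p.2 = 0
  · rw [invGamma_eq_zero_iff.2 h, eq_comm, mul_eq_zero, invGamma_eq_zero_iff, invGamma_eq_zero_iff]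
    exact hiff.1 h
  · obtain ⟨h1, h2⟩ := not_or.1 (mt hiff.2 h)
    obtain ⟨Z₁, hZ₁⟩ := exists_isBarnesZeta (ω := Fin.tail p.2) (fun i => hp i.succ) p.1
    obtain ⟨Z₂, hZ₂⟩ := exists_isBarnesZeta hp (p.1 + p.2 0)
    rw [(hZ₁.succ hZ₂).invGamma_eq h,
      IsBarnesZeta.invGamma_eq (p := (p.1, Fin.tail p.2)) hZ₁ h1,
      IsBarnesZeta.invGamma_eq (p := (p.1 + p.2 0, p.2)) hZ₂ h2, ← Complex.exp_add]
    congr 1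
    have := (hZ₁.differentiableAt_zero.hasDerivAt.add hZ₂.differentiableAt_zero.hasDerivAt).deriv
    rw [show (fun s => Z₁ s + Z₂ s) = Z₁ + Z₂ from rfl, this, neg_add]

theorem ne_zero_of_mem_upperParams {r : ℕ} {p : ℂ × (Fin r → ℂ)} (hp : p ∈ upperParams r) :
    ¬∃ n : Fin r → ℕ, p.1 + dot n p.2 = 0 := by
  rintro ⟨n, hn⟩
  have h := congrArg Complex.im hn
  simp only [dot, Complex.add_im, Complex.im_sum, Complex.mul_im, Complex.natCast_re,
    Complex.natCast_im, zero_mul, add_zero, Complex.zero_im] at h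
  have : 0 ≤ ∑ i, (n i : ℝ) * (p.2 i).im :=
    Finset.sum_nonneg fun i _ => mul_nonneg (Nat.cast_nonneg _) (hp.2 i).le
  linarith [hp.1]

theorem zero_mem_zetaDomain (r : ℕ) : (0 : ℂ) ∈ zetaDomain r := ⟨by simp, fun k hk h => by
  have := (Finset.mem_Icc.1 hk).1
  rw [eq_comm, Nat.cast_eq_zero] at h
  omega⟩

theorem deriv_fst_eq_fderiv {E : Type*} [NormedAddCommGroup E] [NormedSpace ℂ E]
    {Z : ℂ → E → ℂ} {s : ℂ} {p : E}
    (h : DifferentiableAt ℂ (fun q : ℂ × E => Z q.1 q.2) (s, p)) :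
    deriv (fun s => Z s p) s = fderiv ℂ (fun q : ℂ × E => Z q.1 q.2) (s, p) (1, 0) := by
  have h1 : HasDerivAt (fun s : ℂ => (s, p)) (1, 0) s :=
    (hasDerivAt_id s).prodMk (hasDerivAt_const s p)
  exact (h.hasFDerivAt.comp_hasDerivAt s h1).deriv

theorem differentiableAt_invGamma_of_mem_upperParams {r : ℕ} {p : ℂ × (Fin r → ℂ)}
    (hp : p ∈ upperParams r) : DifferentiableAt ℂ (invGamma (r := r)) p := by
  obtain ⟨W, hW, hpW, hWu, Z, hd, hZ, -⟩ := exists_nhds_isBarnesZeta hp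
  have hopen := (isOpen_zetaDomain r).prod hW
  have h1 : DifferentiableOn ℂ (fun p => fderiv ℂ
      (fun q : ℂ × ℂ × (Fin r → ℂ) => Z q.1 q.2) (0, p) (1, 0)) W :=
    (differentiableOn_fderiv_apply hopen hd (1, 0)).comp
      (f := fun p : ℂ × (Fin r → ℂ) => ((0 : ℂ), p))
      (Differentiable.differentiableOn (by fun_prop)) fun p hp => ⟨zero_mem_zetaDomain r, hp⟩
  refine ((h1 p hpW).differentiableAt (hW.mem_nhds hpW)).neg.cexp.congr_of_eventuallyEq ?_
  filter_upwards [hW.mem_nhds hpW] with p' hp'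
  have hmem : ((0 : ℂ), p') ∈ zetaDomain r ×ˢ W := ⟨zero_mem_zetaDomain r, hp'⟩
  rw [(hZ p' hp').invGamma_eq (ne_zero_of_mem_upperParams (hWu hp')), Pi.neg_apply,
    deriv_fst_eq_fderiv ((hd _ hmem).differentiableAt (hopen.mem_nhds hmem))]

/-- `1 / Γ_r (z | ω)` is entire in `z` and jointly holomorphic in `(z, ω)`. -/
theorem differentiableAt_invGamma : ∀ {r : ℕ} {p : ℂ × (Fin r → ℂ)}, (∀ i, 0 < (p.2 i).im) →
    DifferentiableAt ℂ (invGamma (r := r)) p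
  | 0, p, _ => by
    -- In rank 0 the series is the single term z^{-s}, so Γ₀(z) = 1/z; the value 0 at poles makes
    -- the formula hold at z = 0 too.
    have : invGamma (r := 0) = fun p => p.1 := by
      funext p
      by_cases h : p.1 = 0
      · rw [h, invGamma_eq_zero_iff]
        exact ⟨0, by rw [dot_zero, h, add_zero]⟩
      · rw [(isBarnesZeta_zero p.2 h).invGamma_eq (by simpa [dot] using h)]
        have h1 : HasDerivAt (fun s : ℂ => p.1 ^ (-s)) (p.1 ^ (-(0 : ℂ)) * Complex.log p.1 * -1) 0 :=
          (hasDerivAt_id (0 : ℂ)).neg.const_cpow (Or.inl h)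
        rw [h1.deriv]
        simp [Complex.exp_log h]
    rw [this]
    fun_prop
  | r + 1, p, hp => by
    obtain ⟨N, hN⟩ := exists_nat_im_pos p.1 (hp 0)
    induction N generalizing p with
    | zero => exact differentiableAt_invGamma_of_mem_upperParams ⟨by simpa using hN, hp⟩
    | succ N ih =>
      have h1 : DifferentiableAt ℂ (fun p : ℂ × (Fin (r + 1) → ℂ) =>
          invGamma (p.1, Fin.tail p.2)) p :=
        DifferentiableAt.comp p (f := fun p : ℂ × (Fin (r + 1) → ℂ) => (p.1, Fin.tail p.2))
          (differentiableAt_invGamma fun i => hp i.succ) (by unfold Fin.tail; fun_prop)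
      have h2 : DifferentiableAt ℂ (fun p : ℂ × (Fin (r + 1) → ℂ) =>
          invGamma (p.1 + p.2 0, p.2)) p :=
        DifferentiableAt.comp p (f := fun p : ℂ × (Fin (r + 1) → ℂ) => (p.1 + p.2 0, p.2))
          (ih (p := (p.1 + p.2 0, p.2)) hp (by
            have : p.1 + p.2 0 + N * p.2 0 = p.1 + (N + 1 : ℕ) * p.2 0 := by push_cast; ring
            rwa [this])) (by fun_prop)
      refine (h1.mul h2).congr_of_eventuallyEq ?_
      have hopen : IsOpen {p : ℂ × (Fin (r + 1) → ℂ) | ∀ i, 0 < (p.2 i).im} := by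
        simp only [ofPred_forall]
        exact isOpen_iInter_of_finite fun i => isOpen_lt (by fun_prop) (by fun_prop)
      filter_upwards [hopen.mem_nhds hp] with p' hp' using invGamma_succ hp'

/-! ### From kernel relations to relations between gamma functions -/

theorem fderiv_snd_eq_fderiv {E : Type*} [NormedAddCommGroup E] [NormedSpace ℂ E]
    {Z : ℂ → E → ℂ} {s : ℂ} {p : E}
    (h : DifferentiableAt ℂ (fun q : ℂ × E => Z q.1 q.2) (s, p)) (v : E) :
    fderiv ℂ (Z s) p v = fderiv ℂ (fun q : ℂ × E => Z q.1 q.2) (s, p) (0, v) := by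
  have h1 : HasFDerivAt (fun p : E => (s, p)) (ContinuousLinearMap.inr ℂ ℂ E) p :=
    (hasFDerivAt_const s p).prodMk (hasFDerivAt_id p)
  have h2 := (h.hasFDerivAt.comp p h1).fderiv
  have h3 : ((fun q : ℂ × E => Z q.1 q.2) ∘ fun p : E => (s, p)) = Z s := rfl
  rw [h3] at h2
  rw [h2]
  rfl

theorem fderiv_integral_kernel {r : ℕ} {p : ℂ × (Fin r → ℂ)} (hp : p ∈ upperParams r)
    (v : ℂ × (Fin r → ℂ)) {s : ℂ} (hs : r < s.re) :
    IntegrableOn (fun t : ℝ => (t : ℂ) ^ (s - 1) * fderiv ℂ (kernel (r := r) (t : ℂ)) p v)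
        (Ioi 0) ∧
      fderiv ℂ (fun p : ℂ × (Fin r → ℂ) => ∫ t : ℝ in Ioi 0, (t : ℂ) ^ (s - 1) * kernel t p) p v =
        ∫ t : ℝ in Ioi 0, (t : ℂ) ^ (s - 1) * fderiv ℂ (kernel (r := r) (t : ℂ)) p v := by
  obtain ⟨W, hW, hpW, b, hb, -, -, -, -, -, hWb, -⟩ := exists_nhds_regularKernel hp
  have hpos : ∀ p ∈ W, ∀ i, 0 < (p.2 i).im := fun p hp i => hb.trans_le ((hWb p hp).2 i)
  have hF : ∀ᵐ t : ℝ ∂(volume.restrict (Ioi (0 : ℝ))), DifferentiableOn ℂ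
      (fun p : ℂ × (Fin r → ℂ) => (t : ℂ) ^ (s - 1) * kernel t p) W := by
    filter_upwards [self_mem_ae_restrict measurableSet_Ioi] with t ht p hp
    exact ((differentiableAt_kernel (hpos p hp) ht).const_mul _).differentiableWithinAt
  have hm : ∀ p ∈ W, AEStronglyMeasurable (fun t : ℝ => (t : ℂ) ^ (s - 1) * kernel t p)
      (volume.restrict (Ioi (0 : ℝ))) := fun p hp => ((continuousOn_cpow _).mul
    (continuousOn_kernel (hpos p hp))).aestronglyMeasurable measurableSet_Ioi
  have hbd : ∀ᵐ t : ℝ ∂(volume.restrict (Ioi (0 : ℝ))), ∀ p ∈ W,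
      ‖(t : ℂ) ^ (s - 1) * kernel t p‖ ≤
        t ^ (s.re - 1) * (Real.exp (-(b * t)) * (1 + (b * t)⁻¹) ^ r) := by
    filter_upwards [self_mem_ae_restrict measurableSet_Ioi] with t ht p hp
    rw [norm_mul, Complex.norm_cpow_eq_rpow_re_of_pos ht]
    exact mul_le_mul_of_nonneg_left (norm_kernel_le hb (hWb p hp).1 (hWb p hp).2 ht)
      (Real.rpow_nonneg (le_of_lt ht) _)
  have hderiv : ∀ t ∈ Ioi (0 : ℝ), fderiv ℂ (fun p : ℂ × (Fin r → ℂ) =>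
      (t : ℂ) ^ (s - 1) * kernel t p) p v =
        (t : ℂ) ^ (s - 1) * fderiv ℂ (kernel (r := r) (t : ℂ)) p v := fun t ht => by
    rw [fderiv_const_mul (differentiableAt_kernel (hpos p hpW) ht)]
    rfl
  constructor
  · have h1 := (hasFDerivAt_integral_of_norm_le hW hF hm hbd (integrableOn_majorant hb hb hs)
      hpW).1
    exact (integrableOn_congr_fun hderiv measurableSet_Ioi).1 (h1.apply_continuousLinearMap v)
  · rw [fderiv_integral_apply hW hF hm hbd (integrableOn_majorant hb hb hs) hpW v]
    exact setIntegral_congr_fun measurableSet_Ioi hderiv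

/-- The directional derivative of `ζ_r` in its parameters. -/
theorem exists_directional_deriv_zeta {r : ℕ} {p : ℂ × (Fin r → ℂ)} (hp : p ∈ upperParams r)
    (v : ℂ × (Fin r → ℂ)) :
    ∃ A : ℂ → ℂ, DifferentiableOn ℂ A (zetaDomain r) ∧
      fderiv ℂ (invGamma (r := r)) p v = -deriv A 0 * invGamma p ∧
      ∀ s : ℂ, r < s.re → A s = Complex.exp (-(π * Complex.I / 2 * s)) * (Complex.Gamma s)⁻¹ *
        ∫ t : ℝ in Ioi 0, (t : ℂ) ^ (s - 1) * fderiv ℂ (kernel (r := r) (t : ℂ)) p v := by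
  obtain ⟨W, hW, hpW, hWu, Z, hd, hZ, hint⟩ := exists_nhds_isBarnesZeta hp
  set Φ : ℂ × ℂ × (Fin r → ℂ) → ℂ := fun q => Z q.1 q.2 with hΦ
  have hopen := (isOpen_zetaDomain r).prod hW
  have hat : ∀ s ∈ zetaDomain r, ∀ p ∈ W, DifferentiableAt ℂ Φ (s, p) := fun s hs p hp =>
    (hd (s, p) ⟨hs, hp⟩).differentiableAt (hopen.mem_nhds ⟨hs, hp⟩)
  have h0 := zero_mem_zetaDomain r
  -- A is ∂_v ζ. Since 1/Γ_r = exp(-∂_s ζ) at s = 0, its derivative along v involves ∂_v ∂_s ζ,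
  -- which symmetry turns into A'(0).
  refine ⟨fun s => fderiv ℂ Φ (s, p) (0, v), ?_, ?_, fun s hs => ?_⟩
  · exact (differentiableOn_fderiv_apply hopen hd (0, v)).comp
      (f := fun s : ℂ => (s, p)) (Differentiable.differentiableOn (by fun_prop))
      fun s hs => ⟨hs, hpW⟩
  · set Ψ : ℂ × ℂ × (Fin r → ℂ) → ℂ := fun q => fderiv ℂ Φ q (1, 0) with hΨ
    have hΨd : DifferentiableAt ℂ Ψ (0, p) :=
      ((differentiableOn_fderiv_apply hopen hd (1, 0)) (0, p) ⟨h0, hpW⟩).differentiableAt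
        (hopen.mem_nhds ⟨h0, hpW⟩)
    have hΨ' : DifferentiableAt ℂ (fun p => Ψ (0, p)) p :=
      DifferentiableAt.comp p (f := fun p => ((0 : ℂ), p)) hΨd (by fun_prop)
    have heq : invGamma (r := r) =ᶠ[𝓝 p] fun p => Complex.exp (-Ψ (0, p)) := by
      filter_upwards [hW.mem_nhds hpW] with p' hp'
      rw [(hZ p' hp').invGamma_eq (ne_zero_of_mem_upperParams (hWu hp')),
        deriv_fst_eq_fderiv (hat 0 h0 p' hp')]
    have h1 : fderiv ℂ (fun p => Ψ (0, p)) p v = fderiv ℂ Ψ (0, p) (0, v) :=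
      fderiv_snd_eq_fderiv (Z := fun s p => Ψ (s, p)) hΨd v
    have h2 : deriv (fun s => fderiv ℂ Φ (s, p) (0, v)) 0 =
        fderiv ℂ (fun q => fderiv ℂ Φ q (0, v)) (0, p) (1, 0) :=
      deriv_fst_eq_fderiv (Z := fun s p => fderiv ℂ Φ (s, p) (0, v))
        (((differentiableOn_fderiv_apply hopen hd (0, v)) (0, p) ⟨h0, hpW⟩).differentiableAt
          (hopen.mem_nhds ⟨h0, hpW⟩))
    have h3 : HasFDerivAt (fun p => Complex.exp (-Ψ (0, p)))
        (Complex.exp (-Ψ (0, p)) • -fderiv ℂ (fun p => Ψ (0, p)) p) p :=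
      hΨ'.hasFDerivAt.neg.cexp
    rw [h2, ← fderiv_fderiv_apply_comm hopen hd ⟨h0, hpW⟩ (1, 0) (0, v), ← h1, heq.fderiv_eq,
      h3.fderiv, heq.eq_of_nhds]
    simp [mul_comm]
  · have hs' := mem_zetaDomain_of_lt hs
    have h1 : Z s =ᶠ[𝓝 p] fun p => Complex.exp (-(π * Complex.I / 2 * s)) * (Complex.Gamma s)⁻¹ *
        ∫ t : ℝ in Ioi 0, (t : ℂ) ^ (s - 1) * kernel t p := by
      filter_upwards [hW.mem_nhds hpW] with p' hp' using hint p' hp' s hs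
    have hc : Complex.exp (-(π * Complex.I / 2 * s)) * (Complex.Gamma s)⁻¹ ≠ 0 :=
      mul_ne_zero (Complex.exp_ne_zero _) (inv_ne_zero (Complex.Gamma_ne_zero_of_re_pos
        ((Nat.cast_nonneg r).trans_lt hs)))
    have h2 : DifferentiableAt ℂ (fun p : ℂ × (Fin r → ℂ) =>
        ∫ t : ℝ in Ioi 0, (t : ℂ) ^ (s - 1) * kernel t p) p := by
      have h3 : DifferentiableAt ℂ (Z s) p :=
        DifferentiableAt.comp p (f := fun p => (s, p)) (hat s hs' p hpW) (by fun_prop)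
      have h4 := (h1.differentiableAt_iff.1 h3).const_mul
        (Complex.exp (-(π * Complex.I / 2 * s)) * (Complex.Gamma s)⁻¹)⁻¹
      simpa only [inv_mul_cancel_left₀ hc] using h4
    have h5 : fderiv ℂ Φ (s, p) (0, v) = fderiv ℂ (Z s) p v :=
      (fderiv_snd_eq_fderiv (hat s hs' p hpW) v).symm
    simp only [h5]
    rw [h1.fderiv_eq, fderiv_const_mul h2, ← (fderiv_integral_kernel hp v hs).2]
    rfl

/-- Integrating `hk` against t^{s-1} gives A₀ = A₁ + A₂ for large Re s, hence equality of
derivatives at 0. Denominators are cleared so that both sides are entire in z. -/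
theorem fderiv_invGamma_relation_of_mem_upperParams {r₀ r₁ r₂ : ℕ} {p₀ v₀ : ℂ × (Fin r₀ → ℂ)}
    {p₁ v₁ : ℂ × (Fin r₁ → ℂ)} {p₂ v₂ : ℂ × (Fin r₂ → ℂ)} (h₀ : p₀ ∈ upperParams r₀)
    (h₁ : p₁ ∈ upperParams r₁) (h₂ : p₂ ∈ upperParams r₂)
    (hk : ∀ t : ℝ, 0 < t → fderiv ℂ (kernel (r := r₀) (t : ℂ)) p₀ v₀ =
      fderiv ℂ (kernel (r := r₁) (t : ℂ)) p₁ v₁ + fderiv ℂ (kernel (r := r₂) (t : ℂ)) p₂ v₂) :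
    fderiv ℂ (invGamma (r := r₀)) p₀ v₀ * invGamma p₁ * invGamma p₂ =
      invGamma p₀ * (fderiv ℂ (invGamma (r := r₁)) p₁ v₁ * invGamma p₂ +
        invGamma p₁ * fderiv ℂ (invGamma (r := r₂)) p₂ v₂) := by
  obtain ⟨A₀, hA₀, hd₀, he₀⟩ := exists_directional_deriv_zeta h₀ v₀
  obtain ⟨A₁, hA₁, hd₁, he₁⟩ := exists_directional_deriv_zeta h₁ v₁
  obtain ⟨A₂, hA₂, hd₂, he₂⟩ := exists_directional_deriv_zeta h₂ v₂
  suffices hmain : deriv A₀ 0 = deriv A₁ 0 + deriv A₂ 0 by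
    rw [hd₀, hd₁, hd₂, hmain]
    ring
  set R := max r₀ (max r₁ r₂)
  have hR₀ : r₀ ≤ R := le_max_left _ _
  have hR₁ : r₁ ≤ R := (le_max_left _ _).trans (le_max_right _ _)
  have hR₂ : r₂ ≤ R := (le_max_right _ _).trans (le_max_right _ _)
  have hanti : ∀ {r : ℕ}, r ≤ R → zetaDomain R ⊆ zetaDomain r := fun {r} hr s hs =>
    ⟨hs.1, fun k hk => hs.2 k (Finset.Icc_subset_Icc_right hr hk)⟩
  have hlt : ∀ {r : ℕ} {s : ℂ}, r ≤ R → (R : ℝ) < s.re → (r : ℝ) < s.re := fun {r s} hr hs =>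
    lt_of_le_of_lt (Nat.cast_le.2 hr) hs
  have hsum : ∀ s : ℂ, (R : ℝ) < s.re → A₀ s = A₁ s + A₂ s := by
    intro s hs
    rw [he₀ s (hlt hR₀ hs), he₁ s (hlt hR₁ hs), he₂ s (hlt hR₂ hs), ← mul_add, ← integral_add
      (fderiv_integral_kernel h₁ v₁ (hlt hR₁ hs)).1 (fderiv_integral_kernel h₂ v₂ (hlt hR₂ hs)).1]
    congr 1
    exact setIntegral_congr_fun measurableSet_Ioi fun t ht => by simp only [hk t ht, mul_add]
  -- The identity theorem on the punctured domain is borrowed from uniqueness of continued zeta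
  -- functions: adding A₀ - (A₁ + A₂), which vanishes for Re s > R, to any Barnes zeta function
  -- gives another continuation of the same series. The parameters chosen are immaterial.
  obtain ⟨Z, hZ⟩ := exists_isBarnesZeta (r := R) (ω := fun _ => Complex.I) (fun _ => by simp) 0
  have hZ' : IsBarnesZeta (fun _ : Fin R => Complex.I) 0
      (fun s => Z s + (A₀ s - (A₁ s + A₂ s))) := by
    refine ⟨hZ.1.add ((hA₀.mono (hanti hR₀)).sub
      ((hA₁.mono (hanti hR₁)).add (hA₂.mono (hanti hR₂)))), fun s hs => ?_⟩
    simp only [hsum s hs, sub_self, add_zero]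
    exact hZ.2 s hs
  have hat : ∀ {r : ℕ} {A : ℂ → ℂ}, DifferentiableOn ℂ A (zetaDomain r) →
      HasDerivAt A (deriv A 0) 0 := fun {r A} hA =>
    ((hA 0 (zero_mem_zetaDomain r)).differentiableAt
      ((isOpen_zetaDomain r).mem_nhds (zero_mem_zetaDomain r))).hasDerivAt
  have h := hZ'.deriv_eq hZ
  have h' : HasDerivAt (fun s => Z s + (A₀ s - (A₁ s + A₂ s)))
      (deriv Z 0 + (deriv A₀ 0 - (deriv A₁ 0 + deriv A₂ 0))) 0 :=
    hZ.differentiableAt_zero.hasDerivAt.add ((hat hA₀).sub ((hat hA₁).add (hat hA₂)))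
  rw [h'.deriv] at h
  exact sub_eq_zero.1 (add_eq_left.1 h)

theorem isOpen_setOf_im_pos (r : ℕ) :
    IsOpen {p : ℂ × (Fin r → ℂ) | ∀ i, 0 < (p.2 i).im} := by
  simp only [ofPred_forall]
  exact isOpen_iInter_of_finite fun i => isOpen_lt (by fun_prop) (by fun_prop)

theorem differentiable_invGamma_comp {r : ℕ} {ω : Fin r → ℂ} (hω : ∀ i, 0 < (ω i).im) (a : ℂ)
    (v : ℂ × (Fin r → ℂ)) :
    Differentiable ℂ (fun z : ℂ => invGamma (z + a, ω)) ∧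
      Differentiable ℂ (fun z : ℂ => fderiv ℂ (invGamma (r := r)) (z + a, ω) v) := by
  have h := differentiableOn_fderiv_apply (isOpen_setOf_im_pos r) (f := invGamma (r := r))
    (fun p hp => (differentiableAt_invGamma hp).differentiableWithinAt) v
  refine ⟨fun z => DifferentiableAt.comp z (f := fun z : ℂ => (z + a, ω))
    (differentiableAt_invGamma hω) (by fun_prop), fun z => ?_⟩
  exact DifferentiableAt.comp z (f := fun z : ℂ => (z + a, ω))
    (g := fun p => fderiv ℂ (invGamma (r := r)) p v)
    ((h (z + a, ω) hω).differentiableAt ((isOpen_setOf_im_pos r).mem_nhds hω)) (by fun_prop)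

/-- A linear relation between derivatives of `kernel` yields the same relation between logarithmic
derivatives of `1 / Γ_r`, at every `z` where these make sense. -/
theorem fderiv_invGamma_div_eq_add {r₀ r₁ r₂ : ℕ} {ω₀ : Fin r₀ → ℂ} {ω₁ : Fin r₁ → ℂ}
    {ω₂ : Fin r₂ → ℂ} (h₀ : ∀ i, 0 < (ω₀ i).im) (h₁ : ∀ i, 0 < (ω₁ i).im)
    (h₂ : ∀ i, 0 < (ω₂ i).im) {a₀ a₁ a₂ : ℂ} {v₀ : ℂ × (Fin r₀ → ℂ)} {v₁ : ℂ × (Fin r₁ → ℂ)}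
    {v₂ : ℂ × (Fin r₂ → ℂ)}
    (hk : ∀ (z : ℂ) (t : ℝ), 0 < t → fderiv ℂ (kernel (r := r₀) (t : ℂ)) (z + a₀, ω₀) v₀ =
      fderiv ℂ (kernel (r := r₁) (t : ℂ)) (z + a₁, ω₁) v₁ +
        fderiv ℂ (kernel (r := r₂) (t : ℂ)) (z + a₂, ω₂) v₂) {z : ℂ}
    (hn₀ : invGamma (z + a₀, ω₀) ≠ 0) (hn₁ : invGamma (z + a₁, ω₁) ≠ 0)
    (hn₂ : invGamma (z + a₂, ω₂) ≠ 0) :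
    fderiv ℂ (invGamma (r := r₀)) (z + a₀, ω₀) v₀ / invGamma (z + a₀, ω₀) =
      fderiv ℂ (invGamma (r := r₁)) (z + a₁, ω₁) v₁ / invGamma (z + a₁, ω₁) +
        fderiv ℂ (invGamma (r := r₂)) (z + a₂, ω₂) v₂ / invGamma (z + a₂, ω₂) := by
  obtain ⟨d₀, d₀'⟩ := differentiable_invGamma_comp h₀ a₀ v₀
  obtain ⟨d₁, d₁'⟩ := differentiable_invGamma_comp h₁ a₁ v₁
  obtain ⟨d₂, d₂'⟩ := differentiable_invGamma_comp h₂ a₂ v₂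
  have key : (fun z => fderiv ℂ (invGamma (r := r₀)) (z + a₀, ω₀) v₀ * invGamma (z + a₁, ω₁) *
        invGamma (z + a₂, ω₂)) =
      fun z => invGamma (z + a₀, ω₀) * (fderiv ℂ (invGamma (r := r₁)) (z + a₁, ω₁) v₁ *
        invGamma (z + a₂, ω₂) +
        invGamma (z + a₁, ω₁) * fderiv ℂ (invGamma (r := r₂)) (z + a₂, ω₂) v₂) := by
    -- For Im z > M all three points z + a_j lie in the upper half-plane.
    set M := |a₀.im| + |a₁.im| + |a₂.im| with hM
    have hopen : IsOpen {z : ℂ | M < z.im} := isOpen_lt continuous_const Complex.continuous_im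
    have hmem : ((M + 1 : ℝ) : ℂ) * Complex.I ∈ {z : ℂ | M < z.im} := by simp
    refine AnalyticOnNhd.eq_of_eventuallyEq (z₀ := ((M + 1 : ℝ) : ℂ) * Complex.I)
      (fun x _ => ((d₀'.mul d₁).mul d₂).analyticAt x)
      (fun x _ => (d₀.mul ((d₁'.mul d₂).add (d₁.mul d₂'))).analyticAt x) ?_
    filter_upwards [hopen.mem_nhds hmem] with z hz
    have hz : M < z.im := hz
    have hp : ∀ {a : ℂ}, |a.im| ≤ M → 0 < (z + a).im := fun {a} ha => by
      rw [Complex.add_im]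
      linarith [neg_abs_le a.im]
    have := abs_nonneg a₀.im
    have := abs_nonneg a₁.im
    have := abs_nonneg a₂.im
    exact fderiv_invGamma_relation_of_mem_upperParams ⟨hp (by linarith), h₀⟩
      ⟨hp (by linarith), h₁⟩ ⟨hp (by linarith), h₂⟩ (hk z)
  have := congrFun key z
  field_simp
  linear_combination this

/-! ### The explicit kernel relations -/

theorem fderiv_kernel {r : ℕ} {p : ℂ × (Fin r → ℂ)} (hp : ∀ i, 0 < (p.2 i).im)
    (v : ℂ × (Fin r → ℂ)) {t : ℝ} (ht : 0 < t) :
    fderiv ℂ (kernel (r := r) (t : ℂ)) p v = Complex.I * t * kernel t p * (v.1 +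
      ∑ i, v.2 i * (Complex.exp (Complex.I * p.2 i * t) /
        (1 - Complex.exp (Complex.I * p.2 i * t)))) := by
  have hne : ∀ i, 1 - Complex.exp (Complex.I * p.2 i * t) ≠ 0 := fun i h => by
    have := norm_exp_I_mul_lt_one (hp i) ht
    rw [← sub_eq_zero.1 h] at this
    simp at this
  have hline : HasDerivAt (fun τ : ℂ => p + τ • v) v 0 := by
    simpa using ((hasDerivAt_id (0 : ℂ)).smul_const v).const_add p
  have h1 : HasFDerivAt (kernel (r := r) (t : ℂ)) (fderiv ℂ (kernel (r := r) (t : ℂ)) p)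
      (p + (0 : ℂ) • v) := by
    simpa using (differentiableAt_kernel hp ht).hasFDerivAt
  have h2 := h1.comp_hasDerivAt (0 : ℂ) hline
  have he : ∀ x y : ℂ, HasDerivAt (fun τ : ℂ => Complex.exp (Complex.I * (x + τ * y) * t))
      (Complex.exp (Complex.I * x * t) * (Complex.I * y * t)) 0 := fun x y => by
    have h3 : HasDerivAt (fun τ : ℂ => Complex.I * (x + τ * y) * t) (Complex.I * y * t) 0 := by
      simpa using ((((hasDerivAt_id (0 : ℂ)).mul_const y).const_add x).const_mul
        Complex.I).mul_const (t : ℂ)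
    simpa using h3.cexp
  have h4 : ∀ i, HasDerivAt (fun τ : ℂ =>
      (1 - Complex.exp (Complex.I * (p.2 i + τ * v.2 i) * t))⁻¹)
      ((1 - Complex.exp (Complex.I * p.2 i * t))⁻¹ * (Complex.I * t * (v.2 i *
        (Complex.exp (Complex.I * p.2 i * t) /
          (1 - Complex.exp (Complex.I * p.2 i * t)))))) 0 := fun i => by
    have h5 := ((he (p.2 i) (v.2 i)).const_sub 1).fun_inv (by simpa using hne i)
    refine h5.congr_deriv ?_
    have := hne i
    simp only [zero_mul, add_zero]
    field_simp
  have h6 := (he p.1 v.1).mul (HasDerivAt.fun_finsetProd (u := Finset.univ) fun i _ => h4 i)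
  have h7 := h2.unique (f := fun τ : ℂ => kernel (t : ℂ) (p + τ • v)) h6
  rw [h7]
  simp only [zero_mul, add_zero, smul_eq_mul]
  have h8 : ∀ i : Fin r, (∏ j ∈ Finset.univ.erase i,
      (1 - Complex.exp (Complex.I * p.2 j * t))⁻¹) * (1 - Complex.exp (Complex.I * p.2 i * t))⁻¹ =
        ∏ j, (1 - Complex.exp (Complex.I * p.2 j * t))⁻¹ := fun i =>
    Finset.prod_erase_mul _ _ (Finset.mem_univ i)
  simp only [← mul_assoc _ (1 - Complex.exp (Complex.I * p.2 _ * t))⁻¹, h8, ← Finset.mul_sum]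
  rw [kernel]
  ring

theorem kernel_two (t x a b : ℂ) : kernel t (x, ![a, b]) = Complex.exp (Complex.I * x * t) *
    ((1 - Complex.exp (Complex.I * a * t))⁻¹ * (1 - Complex.exp (Complex.I * b * t))⁻¹) := by
  rw [kernel, Fin.prod_univ_two]
  rfl

theorem kernel_three (t x a b c : ℂ) : kernel t (x, ![a, b, c]) =
    Complex.exp (Complex.I * x * t) * ((1 - Complex.exp (Complex.I * a * t))⁻¹ *
      (1 - Complex.exp (Complex.I * b * t))⁻¹ * (1 - Complex.exp (Complex.I * c * t))⁻¹) := by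
  rw [kernel, Fin.prod_univ_three]
  rfl

theorem one_sub_exp_I_mul_ne_zero {x : ℂ} (hx : 0 < x.im) {t : ℝ} (ht : 0 < t) :
    1 - Complex.exp (Complex.I * x * t) ≠ 0 := fun h => by
  have := norm_exp_I_mul_lt_one hx ht
  rw [← sub_eq_zero.1 h] at this
  simp at this

section Relations

variable {z ω₁ ω₂ : ℂ}

theorem im_two_mul_pos (h₂ : 0 < ω₂.im) : 0 < (2 * ω₂).im := by simpa using h₂

theorem im_pos_two {a b : ℂ} (ha : 0 < a.im) (hb : 0 < b.im) : ∀ i, 0 < (![a, b] i).im := by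
  intro i
  fin_cases i <;> simpa

theorem im_pos_three {a b c : ℂ} (ha : 0 < a.im) (hb : 0 < b.im) (hc : 0 < c.im) :
    ∀ i, 0 < (![a, b, c] i).im := by
  intro i
  fin_cases i <;> simpa

/-- With q = e^{iω₂t} this is q d/dq [q/(1-q²)] = (q+q³)/(1-q²)². The direction (1, ![0, 2]) is the
velocity of w ↦ (z + w, ![ω₁, 2w]). -/
theorem fderiv_kernel_two_relation (h₁ : 0 < ω₁.im) (h₂ : 0 < ω₂.im) (z : ℂ) {t : ℝ} (ht : 0 < t) :
    fderiv ℂ (kernel (r := 2) (t : ℂ)) (z + ω₂, ![ω₁, 2 * ω₂]) (1, ![0, 2]) =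
      fderiv ℂ (kernel (r := 3) (t : ℂ)) (z + 3 * ω₂, ![2 * ω₂, 2 * ω₂, ω₁]) (1, 0) +
        fderiv ℂ (kernel (r := 3) (t : ℂ)) (z + ω₂, ![2 * ω₂, 2 * ω₂, ω₁]) (1, 0) := by
  have h2' := im_two_mul_pos h₂
  have ha := one_sub_exp_I_mul_ne_zero h₁ ht
  have hb := one_sub_exp_I_mul_ne_zero h2' ht
  rw [fderiv_kernel (im_pos_two h₁ h2') _ ht, fderiv_kernel (im_pos_three h2' h2' h₁) _ ht,
    fderiv_kernel (im_pos_three h2' h2' h₁) _ ht, kernel_two, kernel_three, kernel_three]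
  have e1 : Complex.exp (Complex.I * (z + ω₂) * t) =
      Complex.exp (Complex.I * z * t) * Complex.exp (Complex.I * ω₂ * t) := by
    rw [← Complex.exp_add]; ring_nf
  have e3 : Complex.exp (Complex.I * (z + 3 * ω₂) * t) =
      Complex.exp (Complex.I * z * t) * Complex.exp (Complex.I * ω₂ * t) ^ 3 := by
    rw [← Complex.exp_nat_mul, ← Complex.exp_add]; push_cast; ring_nf
  have e2 : Complex.exp (Complex.I * (2 * ω₂) * t) = Complex.exp (Complex.I * ω₂ * t) ^ 2 := by
    rw [← Complex.exp_nat_mul]; push_cast; ring_nf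
  rw [e2] at hb
  simp only [Fin.sum_univ_two, Fin.sum_univ_three, Matrix.cons_val, e1, e2, e3, Pi.zero_apply,
    zero_mul, add_zero, zero_add]
  generalize Complex.exp (Complex.I * ω₂ * t) = q at *
  generalize Complex.exp (Complex.I * ω₁ * t) = a at *
  field_simp
  ring

/-- The same q-identity times a/(1-a)², a = e^{iω₁t}; on the right this factor comes from
differentiating (1-a)⁻¹ in ω₁. -/
theorem fderiv_kernel_three_relation (h₁ : 0 < ω₁.im) (h₂ : 0 < ω₂.im) (z : ℂ) {t : ℝ}
    (ht : 0 < t) :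
    fderiv ℂ (kernel (r := 3) (t : ℂ)) (z + (ω₁ + ω₂), ![ω₁, ω₁, 2 * ω₂]) (1, ![0, 0, 2]) =
      fderiv ℂ (kernel (r := 3) (t : ℂ)) (z + 3 * ω₂, ![2 * ω₂, 2 * ω₂, ω₁]) (0, ![0, 0, 1]) +
        fderiv ℂ (kernel (r := 3) (t : ℂ)) (z + ω₂, ![2 * ω₂, 2 * ω₂, ω₁]) (0, ![0, 0, 1]) := by
  have h2' := im_two_mul_pos h₂
  have ha := one_sub_exp_I_mul_ne_zero h₁ ht
  have hb := one_sub_exp_I_mul_ne_zero h2' ht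
  rw [fderiv_kernel (im_pos_three h₁ h₁ h2') _ ht, fderiv_kernel (im_pos_three h2' h2' h₁) _ ht,
    fderiv_kernel (im_pos_three h2' h2' h₁) _ ht, kernel_three, kernel_three, kernel_three]
  have e1 : Complex.exp (Complex.I * (z + ω₂) * t) =
      Complex.exp (Complex.I * z * t) * Complex.exp (Complex.I * ω₂ * t) := by
    rw [← Complex.exp_add]; ring_nf
  have e3 : Complex.exp (Complex.I * (z + 3 * ω₂) * t) =
      Complex.exp (Complex.I * z * t) * Complex.exp (Complex.I * ω₂ * t) ^ 3 := by
    rw [← Complex.exp_nat_mul, ← Complex.exp_add]; push_cast; ring_nf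
  have e4 : Complex.exp (Complex.I * (z + (ω₁ + ω₂)) * t) = Complex.exp (Complex.I * z * t) *
      (Complex.exp (Complex.I * ω₁ * t) * Complex.exp (Complex.I * ω₂ * t)) := by
    rw [← Complex.exp_add, ← Complex.exp_add]; ring_nf
  have e2 : Complex.exp (Complex.I * (2 * ω₂) * t) = Complex.exp (Complex.I * ω₂ * t) ^ 2 := by
    rw [← Complex.exp_nat_mul]; push_cast; ring_nf
  rw [e2] at hb
  simp only [Fin.sum_univ_three, Matrix.cons_val, e1, e2, e3, e4,
    zero_mul, add_zero, zero_add]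
  generalize Complex.exp (Complex.I * ω₂ * t) = q at *
  generalize Complex.exp (Complex.I * ω₁ * t) = a at *
  field_simp
  ring

/-- After reflection the arguments on the right contain ω₁, so a/(1-a) is differentiated instead; it
too yields a/(1-a)². -/
theorem fderiv_kernel_three_reflected_relation (h₁ : 0 < ω₁.im) (h₂ : 0 < ω₂.im) (z : ℂ) {t : ℝ}
    (ht : 0 < t) :
    fderiv ℂ (kernel (r := 3) (t : ℂ)) (z + (ω₁ + ω₂), ![ω₁, ω₁, 2 * ω₂]) (1, ![0, 0, 2]) =
      fderiv ℂ (kernel (r := 3) (t : ℂ)) (z + (ω₁ + ω₂), ![2 * ω₂, 2 * ω₂, ω₁]) (1, ![0, 0, 1]) +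
        fderiv ℂ (kernel (r := 3) (t : ℂ)) (z + (ω₁ + 3 * ω₂), ![2 * ω₂, 2 * ω₂, ω₁])
          (1, ![0, 0, 1]) := by
  have h2' := im_two_mul_pos h₂
  have ha := one_sub_exp_I_mul_ne_zero h₁ ht
  have hb := one_sub_exp_I_mul_ne_zero h2' ht
  rw [fderiv_kernel (im_pos_three h₁ h₁ h2') _ ht, fderiv_kernel (im_pos_three h2' h2' h₁) _ ht,
    fderiv_kernel (im_pos_three h2' h2' h₁) _ ht, kernel_three, kernel_three, kernel_three]
  have e3 : Complex.exp (Complex.I * (z + (ω₁ + 3 * ω₂)) * t) = Complex.exp (Complex.I * z * t) *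
      (Complex.exp (Complex.I * ω₁ * t) * Complex.exp (Complex.I * ω₂ * t) ^ 3) := by
    rw [← Complex.exp_nat_mul, ← Complex.exp_add, ← Complex.exp_add]; push_cast; ring_nf
  have e4 : Complex.exp (Complex.I * (z + (ω₁ + ω₂)) * t) = Complex.exp (Complex.I * z * t) *
      (Complex.exp (Complex.I * ω₁ * t) * Complex.exp (Complex.I * ω₂ * t)) := by
    rw [← Complex.exp_add, ← Complex.exp_add]; ring_nf
  have e2 : Complex.exp (Complex.I * (2 * ω₂) * t) = Complex.exp (Complex.I * ω₂ * t) ^ 2 := by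
    rw [← Complex.exp_nat_mul]; push_cast; ring_nf
  rw [e2] at hb
  simp only [Fin.sum_univ_three, Matrix.cons_val, e2, e3, e4,
    zero_mul, add_zero, zero_add]
  generalize Complex.exp (Complex.I * ω₂ * t) = q at *
  generalize Complex.exp (Complex.I * ω₁ * t) = a at *
  field_simp
  ring

end Relations

/-! ### Bernoulli polynomials and multiple sines in terms of 1/Γ_r -/

/-- The explicit form of `B_{3,3}(z | a, a, b)`. -/
theorem multipleBernoulli_three_three {a b : ℂ} (ha : a ≠ 0) (hb : b ≠ 0) (z : ℂ) :
    multipleBernoulli 3 ![a, a, b] z =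
      (z ^ 3 - 3 / 2 * (2 * a + b) * z ^ 2 + (5 / 2 * a ^ 2 + b ^ 2 / 2 + 3 * a * b) * z -
        (2 * a + b) * (a ^ 2 + 2 * a * b) / 4) / (a ^ 2 * b) := by
  have h3 : bernoulli 3 = 0 := by
    rw [bernoulli_eq_bernoulli'_of_ne_one (by norm_num), bernoulli'_three]
  simp [multipleBernoulli, Fin.prod_univ_three, PowerSeries.coeff_mul,
    Finset.Nat.antidiagonal_succ, bernoulliPowerSeries,
    PowerSeries.coeff_rescale, PowerSeries.coeff_exp, PowerSeries.coeff_C, h3, Nat.factorial]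
  field_simp
  ring

theorem multipleSine_two (ω : Fin 2 → ℂ) (z : ℂ) :
    multipleSine ω z = invGamma (z, ω) * (invGamma (∑ i, ω i - z, ω))⁻¹ := by
  simp [multipleSine, invGamma]

theorem multipleSine_three (ω : Fin 3 → ℂ) (z : ℂ) :
    multipleSine ω z = invGamma (z, ω) * invGamma (∑ i, ω i - z, ω) := by
  have : ((-1 : ℤ) ^ 3) = -1 := by norm_num
  rw [multipleSine, this, zpow_neg_one]
  rfl

/-- Every derivative in the theorem moves (z, ω) along an affine line, so the chain rule reduces it
to a directional derivative of 1/Γ_r. -/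
theorem invGamma_comp_line {r : ℕ} {c : ℂ → ℂ × (Fin r → ℂ)} {p v : ℂ × (Fin r → ℂ)} {x : ℂ}
    (hc : ∀ w, c w = p + (w - x) • v) (hp : ∀ i, 0 < (p.2 i).im) (hn : invGamma p ≠ 0) :
    AnalyticAt ℂ (fun w => invGamma (c w)) x ∧ invGamma (c x) ≠ 0 ∧
      logDeriv (fun w => invGamma (c w)) x = fderiv ℂ (invGamma (r := r)) p v / invGamma p := by
  have hx : c x = p := by simp [hc]
  have hline : ∀ w, HasDerivAt c v w := fun w => by
    rw [funext hc]
    simpa using (((hasDerivAt_id w).sub_const x).smul_const v).const_add p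
  have hcomp : ∀ w, (∀ i, 0 < ((c w).2 i).im) →
      HasDerivAt (fun w => invGamma (c w)) (fderiv ℂ (invGamma (r := r)) (c w) v) w := fun w hw =>
    (differentiableAt_invGamma hw).hasFDerivAt.comp_hasDerivAt w (hline w)
  refine ⟨Complex.analyticAt_iff_eventually_differentiableAt.2 ?_, by rwa [hx], ?_⟩
  · filter_upwards [(hline x).continuousAt.preimage_mem_nhds
      ((isOpen_setOf_im_pos r).mem_nhds (by rw [hx]; exact hp))] with w hw
    exact (hcomp w hw).differentiableAt
  · rw [logDeriv_apply, (hcomp x (by rw [hx]; exact hp)).deriv, hx]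

theorem logDeriv_fun_inv_of_ne_zero {f : ℂ → ℂ} {x : ℂ} (hf : DifferentiableAt ℂ f x)
    (hx : f x ≠ 0) : logDeriv (fun w => (f w)⁻¹) x = -logDeriv f x := by
  rw [logDeriv_apply, deriv_fun_inv'' hf hx, logDeriv_apply]
  field_simp

theorem logDeriv_exp_mul_mul {f P g₁ g₂ : ℂ → ℂ} {x P' : ℂ}
    (hf : f =ᶠ[𝓝 x] fun w => Complex.exp (P w) * (g₁ w * g₂ w)) (hPa : AnalyticAt ℂ P x)
    (hP : HasDerivAt P P' x) (h₁ : AnalyticAt ℂ g₁ x) (h₂ : AnalyticAt ℂ g₂ x) (n₁ : g₁ x ≠ 0)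
    (n₂ : g₂ x ≠ 0) :
    f x ≠ 0 ∧ AnalyticAt ℂ f x ∧ logDeriv f x = P' + (logDeriv g₁ x + logDeriv g₂ x) := by
  have he := Complex.exp_ne_zero (P x)
  refine ⟨?_, (analyticAt_congr hf).2 (hPa.cexp.mul (h₁.mul h₂)), ?_⟩
  · rw [hf.eq_of_nhds]
    exact mul_ne_zero he (mul_ne_zero n₁ n₂)
  · have h : logDeriv f x = logDeriv (fun w => Complex.exp (P w) * (g₁ w * g₂ w)) x := by
      rw [logDeriv_apply, logDeriv_apply, hf.deriv_eq, hf.eq_of_nhds]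
    rw [h, logDeriv_mul (f := fun w => Complex.exp (P w)) (g := fun w => g₁ w * g₂ w) x he
        (mul_ne_zero n₁ n₂) hPa.cexp.differentiableAt (h₁.mul h₂).differentiableAt,
      logDeriv_mul x n₁ n₂ h₁.differentiableAt h₂.differentiableAt]
    congr 1
    rw [logDeriv_apply, hP.cexp.deriv, mul_div_cancel_left₀ _ he]

/-- Collected in powers of w, the variable of differentiation; the next lemma does the same for
`G₃`. -/
theorem multipleBernoulli_two_two_shift {ω₁ w : ℂ} (h₁ : ω₁ ≠ 0) (hw : w ≠ 0) (z : ℂ) :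
    multipleBernoulli 2 ![ω₁, 2 * w] (z + w) =
      (z ^ 2 / (2 * ω₁) - z / 2 + ω₁ / 12) * w⁻¹ - w / (6 * ω₁) := by
  rw [multipleBernoulli_two_two h₁ (mul_ne_zero two_ne_zero hw)]
  field_simp
  ring

theorem multipleBernoulli_three_three_shift {ω₁ w : ℂ} (h₁ : ω₁ ≠ 0) (hw : w ≠ 0) (z : ℂ) :
    multipleBernoulli 3 ![ω₁, ω₁, 2 * w] (z + w + ω₁) =
      (z ^ 3 / (2 * ω₁ ^ 2) - z / 4) * w⁻¹ - w * (z / (2 * ω₁ ^ 2)) := by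
  rw [multipleBernoulli_three_three h₁ (mul_ne_zero two_ne_zero hw)]
  field_simp
  ring

theorem multipleBernoulli_three_three_double {ω v : ℂ} (h : ω ≠ 0) (hv : v ≠ 0) (y : ℂ) :
    multipleBernoulli 3 ![2 * ω, 2 * ω, v] (y + 2 * ω) =
      1 / (4 * ω ^ 2) * (y ^ 3 * v⁻¹ - 3 / 2 * y ^ 2 + v * (y / 2)) - y / 2 * v⁻¹ + 1 / 4 := by
  rw [multipleBernoulli_three_three (mul_ne_zero two_ne_zero h) hv]
  field_simp
  ring

theorem F₂_eq (y a b : ℂ) : F₂ y a b =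
    Complex.exp (-(π * Complex.I / 2) * multipleBernoulli 2 ![a, b] y) *
      (invGamma (y, ![a, b]) * (invGamma (a + b - y, ![a, b]))⁻¹) := by
  rw [F₂, multipleSine_two, Fin.sum_univ_two]
  rfl

theorem G₃_eq (y a b : ℂ) : G₃ y a b =
    Complex.exp (π * Complex.I / 6 * multipleBernoulli 3 ![a, a, b] (y + a)) *
      (invGamma (y + a, ![a, a, b]) * invGamma (a + b - y, ![a, a, b])) := by
  rw [G₃, multipleSine_three, Fin.sum_univ_three]
  congr 4
  simp only [Matrix.cons_val]
  ring

/-! ### Logarithmic derivatives of F₂ and G₃ -/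

section MainIdentities

variable {z ω₁ ω₂ : ℂ}

theorem line_two (x : ℂ) (ω₁ w₀ w : ℂ) : ((x + w, ![ω₁, 2 * w]) : ℂ × (Fin 2 → ℂ)) =
    (x + w₀, ![ω₁, 2 * w₀]) + (w - w₀) • ((1, ![0, 2]) : ℂ × (Fin 2 → ℂ)) := by
  refine Prod.ext ?_ (funext fun i => ?_)
  · simp
  · fin_cases i <;> simp
    ring

theorem line_three (x : ℂ) (ω₁ w₀ w : ℂ) : ((x + w, ![ω₁, ω₁, 2 * w]) : ℂ × (Fin 3 → ℂ)) =
    (x + w₀, ![ω₁, ω₁, 2 * w₀]) + (w - w₀) • ((1, ![0, 0, 2]) : ℂ × (Fin 3 → ℂ)) := by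
  refine Prod.ext ?_ (funext fun i => ?_)
  · simp
  · fin_cases i <;> simp
    ring

/-- Analyticity, non-vanishing and logarithmic derivative of `F₂(z + w | ω₁, 2 w)` in `w`. -/
theorem logDeriv_F₂ (h₁ : 0 < ω₁.im) (h₂ : 0 < ω₂.im)
    (n₁ : invGamma (z + ω₂, ![ω₁, 2 * ω₂]) ≠ 0)
    (n₂ : invGamma (-z + (ω₁ + ω₂), ![ω₁, 2 * ω₂]) ≠ 0) :
    F₂ (z + ω₂) ω₁ (2 * ω₂) ≠ 0 ∧ AnalyticAt ℂ (fun w => F₂ (z + w) ω₁ (2 * w)) ω₂ ∧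
      logDeriv (fun w => F₂ (z + w) ω₁ (2 * w)) ω₂ =
        -(π * Complex.I / 2) * (-(z ^ 2 / (2 * ω₁) - z / 2 + ω₁ / 12) / ω₂ ^ 2 - 1 / (6 * ω₁)) +
          (fderiv ℂ (invGamma (r := 2)) (z + ω₂, ![ω₁, 2 * ω₂]) (1, ![0, 2]) /
              invGamma (z + ω₂, ![ω₁, 2 * ω₂]) -
            fderiv ℂ (invGamma (r := 2)) (-z + (ω₁ + ω₂), ![ω₁, 2 * ω₂]) (1, ![0, 2]) /
              invGamma (-z + (ω₁ + ω₂), ![ω₁, 2 * ω₂])) := by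
  have hω₁ : ω₁ ≠ 0 := by rintro rfl; simp at h₁
  have hω₂ : ω₂ ≠ 0 := by rintro rfl; simp at h₂
  have hp := im_pos_two h₁ (im_two_mul_pos h₂)
  obtain ⟨a₁, m₁, l₁⟩ := invGamma_comp_line (c := fun w => (z + w, ![ω₁, 2 * w])) (x := ω₂)
    (line_two z ω₁ ω₂) hp n₁
  obtain ⟨a₂, m₂, l₂⟩ := invGamma_comp_line (c := fun w => (-z + (ω₁ + w), ![ω₁, 2 * w])) (x := ω₂)
    (fun w => by simpa only [add_assoc] using line_two (-z + ω₁) ω₁ ω₂ w) hp n₂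
  have hP : HasDerivAt (fun w => -(π * Complex.I / 2) *
      ((z ^ 2 / (2 * ω₁) - z / 2 + ω₁ / 12) * w⁻¹ - w / (6 * ω₁)))
      (-(π * Complex.I / 2) * ((z ^ 2 / (2 * ω₁) - z / 2 + ω₁ / 12) * -(ω₂ ^ 2)⁻¹ -
        1 / (6 * ω₁))) ω₂ :=
    (((hasDerivAt_inv hω₂).const_mul _).sub ((hasDerivAt_id ω₂).div_const _)).const_mul _
  have hf : (fun w => F₂ (z + w) ω₁ (2 * w)) =ᶠ[𝓝 ω₂] fun w => Complex.exp (-(π * Complex.I / 2) *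
      ((z ^ 2 / (2 * ω₁) - z / 2 + ω₁ / 12) * w⁻¹ - w / (6 * ω₁))) *
      (invGamma (z + w, ![ω₁, 2 * w]) * (invGamma (-z + (ω₁ + w), ![ω₁, 2 * w]))⁻¹) := by
    filter_upwards [isOpen_ne.mem_nhds hω₂] with w hw
    rw [F₂_eq, multipleBernoulli_two_two_shift hω₁ hw,
      show ω₁ + 2 * w - (z + w) = -z + (ω₁ + w) by ring]
  have hPa : AnalyticAt ℂ (fun w => -(π * Complex.I / 2) *
      ((z ^ 2 / (2 * ω₁) - z / 2 + ω₁ / 12) * w⁻¹ - w / (6 * ω₁))) ω₂ := by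
    have : AnalyticAt ℂ (fun w : ℂ => w⁻¹) ω₂ := analyticAt_inv hω₂
    fun_prop
  obtain ⟨h3, h4, h5⟩ := logDeriv_exp_mul_mul hf hPa hP a₁
    (a₂.inv m₂) m₁ (inv_ne_zero m₂)
  refine ⟨h3, h4, ?_⟩
  rw [h5, logDeriv_fun_inv_of_ne_zero a₂.differentiableAt m₂, l₁, l₂, ← sub_eq_add_neg]
  congr 2
  ring

/-- Analyticity, non-vanishing and logarithmic derivative of `G₃(z + w | ω₁, 2 w)` in `w`. -/
theorem logDeriv_G₃_left (h₁ : 0 < ω₁.im) (h₂ : 0 < ω₂.im)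
    (n₁ : invGamma (z + (ω₁ + ω₂), ![ω₁, ω₁, 2 * ω₂]) ≠ 0)
    (n₂ : invGamma (-z + (ω₁ + ω₂), ![ω₁, ω₁, 2 * ω₂]) ≠ 0) :
    G₃ (z + ω₂) ω₁ (2 * ω₂) ≠ 0 ∧ AnalyticAt ℂ (fun w => G₃ (z + w) ω₁ (2 * w)) ω₂ ∧
      logDeriv (fun w => G₃ (z + w) ω₁ (2 * w)) ω₂ =
        π * Complex.I / 6 * (-(z ^ 3 / (2 * ω₁ ^ 2) - z / 4) / ω₂ ^ 2 - z / (2 * ω₁ ^ 2)) +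
          (fderiv ℂ (invGamma (r := 3)) (z + (ω₁ + ω₂), ![ω₁, ω₁, 2 * ω₂]) (1, ![0, 0, 2]) /
              invGamma (z + (ω₁ + ω₂), ![ω₁, ω₁, 2 * ω₂]) +
            fderiv ℂ (invGamma (r := 3)) (-z + (ω₁ + ω₂), ![ω₁, ω₁, 2 * ω₂]) (1, ![0, 0, 2]) /
              invGamma (-z + (ω₁ + ω₂), ![ω₁, ω₁, 2 * ω₂])) := by
  have hω₁ : ω₁ ≠ 0 := by rintro rfl; simp at h₁
  have hω₂ : ω₂ ≠ 0 := by rintro rfl; simp at h₂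
  have hp := im_pos_three h₁ h₁ (im_two_mul_pos h₂)
  obtain ⟨a₁, m₁, l₁⟩ := invGamma_comp_line (c := fun w => (z + (ω₁ + w), ![ω₁, ω₁, 2 * w]))
    (x := ω₂) (fun w => by simpa only [add_assoc] using line_three (z + ω₁) ω₁ ω₂ w) hp n₁
  obtain ⟨a₂, m₂, l₂⟩ := invGamma_comp_line (c := fun w => (-z + (ω₁ + w), ![ω₁, ω₁, 2 * w]))
    (x := ω₂) (fun w => by simpa only [add_assoc] using line_three (-z + ω₁) ω₁ ω₂ w) hp n₂
  have hP : HasDerivAt (fun w => π * Complex.I / 6 *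
      ((z ^ 3 / (2 * ω₁ ^ 2) - z / 4) * w⁻¹ - w * (z / (2 * ω₁ ^ 2))))
      (π * Complex.I / 6 * ((z ^ 3 / (2 * ω₁ ^ 2) - z / 4) * -(ω₂ ^ 2)⁻¹ -
        1 * (z / (2 * ω₁ ^ 2)))) ω₂ :=
    (((hasDerivAt_inv hω₂).const_mul _).sub ((hasDerivAt_id ω₂).mul_const _)).const_mul _
  have hf : (fun w => G₃ (z + w) ω₁ (2 * w)) =ᶠ[𝓝 ω₂] fun w => Complex.exp (π * Complex.I / 6 *
      ((z ^ 3 / (2 * ω₁ ^ 2) - z / 4) * w⁻¹ - w * (z / (2 * ω₁ ^ 2)))) *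
      (invGamma (z + (ω₁ + w), ![ω₁, ω₁, 2 * w]) * invGamma (-z + (ω₁ + w), ![ω₁, ω₁, 2 * w])) := by
    filter_upwards [isOpen_ne.mem_nhds hω₂] with w hw
    rw [G₃_eq, multipleBernoulli_three_three_shift hω₁ hw,
      show ω₁ + 2 * w - (z + w) = -z + (ω₁ + w) by ring, show z + w + ω₁ = z + (ω₁ + w) by ring]
  have hPa : AnalyticAt ℂ (fun w => π * Complex.I / 6 *
      ((z ^ 3 / (2 * ω₁ ^ 2) - z / 4) * w⁻¹ - w * (z / (2 * ω₁ ^ 2)))) ω₂ := by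
    have : AnalyticAt ℂ (fun w : ℂ => w⁻¹) ω₂ := analyticAt_inv hω₂
    fun_prop
  obtain ⟨h3, h4, h5⟩ := logDeriv_exp_mul_mul hf hPa hP a₁
    a₂ m₁ m₂
  refine ⟨h3, h4, ?_⟩
  rw [h5, l₁, l₂]
  congr 2
  ring

/-- Analyticity, non-vanishing and logarithmic derivative of `G₃(· + d | 2 ω₂, ω₁)`. -/
theorem logDeriv_G₃_fst (h₁ : 0 < ω₁.im) (h₂ : 0 < ω₂.im) (d : ℂ)
    (n₁ : invGamma (z + (d + 2 * ω₂), ![2 * ω₂, 2 * ω₂, ω₁]) ≠ 0)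
    (n₂ : invGamma (-z + (ω₁ + (2 * ω₂ - d)), ![2 * ω₂, 2 * ω₂, ω₁]) ≠ 0) :
    G₃ (z + d) (2 * ω₂) ω₁ ≠ 0 ∧ AnalyticAt ℂ (fun w => G₃ (w + d) (2 * ω₂) ω₁) z ∧
      logDeriv (fun w => G₃ (w + d) (2 * ω₂) ω₁) z =
        π * Complex.I / 6 * (1 / (4 * ω₂ ^ 2) * (3 * (z + d) ^ 2 * ω₁⁻¹ - 3 * (z + d) + ω₁ / 2) -
          1 / 2 * ω₁⁻¹) +
          (fderiv ℂ (invGamma (r := 3)) (z + (d + 2 * ω₂), ![2 * ω₂, 2 * ω₂, ω₁]) (1, 0) /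
              invGamma (z + (d + 2 * ω₂), ![2 * ω₂, 2 * ω₂, ω₁]) -
            fderiv ℂ (invGamma (r := 3)) (-z + (ω₁ + (2 * ω₂ - d)), ![2 * ω₂, 2 * ω₂, ω₁]) (1, 0) /
              invGamma (-z + (ω₁ + (2 * ω₂ - d)), ![2 * ω₂, 2 * ω₂, ω₁])) := by
  have hω₁ : ω₁ ≠ 0 := by rintro rfl; simp at h₁
  have hω₂ : ω₂ ≠ 0 := by rintro rfl; simp at h₂
  have hp := im_pos_three (im_two_mul_pos h₂) (im_two_mul_pos h₂) h₁
  obtain ⟨a₁, m₁, l₁⟩ := invGamma_comp_line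
    (c := fun w => (w + (d + 2 * ω₂), ![2 * ω₂, 2 * ω₂, ω₁])) (x := z) (v := (1, 0))
    (fun w => Prod.ext (by simp; ring) (by simp)) hp n₁
  -- The reflected argument contains -w: the direction is -(1, 0), whence the minus sign in the
  -- result.
  obtain ⟨a₂, m₂, l₂⟩ := invGamma_comp_line
    (c := fun w => (-w + (ω₁ + (2 * ω₂ - d)), ![2 * ω₂, 2 * ω₂, ω₁])) (x := z) (v := -(1, 0))
    (fun w => Prod.ext (by simp; ring) (by simp)) hp n₂
  have hP : HasDerivAt (fun w => π * Complex.I / 6 * (1 / (4 * ω₂ ^ 2) *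
      ((w + d) ^ 3 * ω₁⁻¹ - 3 / 2 * (w + d) ^ 2 + ω₁ * ((w + d) / 2)) - (w + d) / 2 * ω₁⁻¹ + 1 / 4))
      (π * Complex.I / 6 * (1 / (4 * ω₂ ^ 2) * ((3 : ℕ) * (z + d) ^ 2 * 1 * ω₁⁻¹ -
        3 / 2 * ((2 : ℕ) * (z + d) ^ 1 * 1) + ω₁ * (1 / 2)) - 1 / 2 * ω₁⁻¹)) z := by
    have h := (hasDerivAt_id z).add_const d
    exact ((((((h.pow 3).mul_const _).sub ((h.pow 2).const_mul _)).add
      ((h.div_const 2).const_mul _)).const_mul _).sub ((h.div_const 2).mul_const _)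
      |>.add_const (1 / 4)).const_mul _
  have hf : (fun w => G₃ (w + d) (2 * ω₂) ω₁) =ᶠ[𝓝 z] fun w => Complex.exp (π * Complex.I / 6 * (1 / (4 * ω₂ ^ 2) *
      ((w + d) ^ 3 * ω₁⁻¹ - 3 / 2 * (w + d) ^ 2 + ω₁ * ((w + d) / 2)) - (w + d) / 2 * ω₁⁻¹ + 1 / 4)) *
      (invGamma (w + (d + 2 * ω₂), ![2 * ω₂, 2 * ω₂, ω₁]) *
        invGamma (-w + (ω₁ + (2 * ω₂ - d)), ![2 * ω₂, 2 * ω₂, ω₁])) := by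
    refine Eventually.of_forall fun w => ?_
    simp only
    rw [G₃_eq, multipleBernoulli_three_three_double hω₂ hω₁,
      show w + d + 2 * ω₂ = w + (d + 2 * ω₂) by ring,
      show 2 * ω₂ + ω₁ - (w + d) = -w + (ω₁ + (2 * ω₂ - d)) by ring]
  have hPa : AnalyticAt ℂ (fun w => π * Complex.I / 6 * (1 / (4 * ω₂ ^ 2) *
      ((w + d) ^ 3 * ω₁⁻¹ - 3 / 2 * (w + d) ^ 2 + ω₁ * ((w + d) / 2)) - (w + d) / 2 * ω₁⁻¹ + 1 / 4)) z := by
    fun_prop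
  obtain ⟨h3, h4, h5⟩ := logDeriv_exp_mul_mul hf hPa hP a₁
    a₂ m₁ m₂
  refine ⟨h3, h4, ?_⟩
  rw [h5, l₁, l₂, map_neg, neg_div, ← sub_eq_add_neg]
  congr 2
  push_cast
  ring

/-- Analyticity and logarithmic derivative of `G₃(z + d | 2 ω₂, ·)`. -/
theorem logDeriv_G₃_snd (h₁ : 0 < ω₁.im) (h₂ : 0 < ω₂.im) (d : ℂ)
    (n₁ : invGamma (z + (d + 2 * ω₂), ![2 * ω₂, 2 * ω₂, ω₁]) ≠ 0)
    (n₂ : invGamma (-z + (ω₁ + (2 * ω₂ - d)), ![2 * ω₂, 2 * ω₂, ω₁]) ≠ 0) :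
    AnalyticAt ℂ (fun w => G₃ (z + d) (2 * ω₂) w) ω₁ ∧
      logDeriv (fun w => G₃ (z + d) (2 * ω₂) w) ω₁ =
        π * Complex.I / 6 * (1 / (4 * ω₂ ^ 2) * (-(z + d) ^ 3 / ω₁ ^ 2 + (z + d) / 2) +
          (z + d) / 2 / ω₁ ^ 2) +
          (fderiv ℂ (invGamma (r := 3)) (z + (d + 2 * ω₂), ![2 * ω₂, 2 * ω₂, ω₁]) (0, ![0, 0, 1]) /
              invGamma (z + (d + 2 * ω₂), ![2 * ω₂, 2 * ω₂, ω₁]) +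
            fderiv ℂ (invGamma (r := 3)) (-z + (ω₁ + (2 * ω₂ - d)), ![2 * ω₂, 2 * ω₂, ω₁])
                (1, ![0, 0, 1]) /
              invGamma (-z + (ω₁ + (2 * ω₂ - d)), ![2 * ω₂, 2 * ω₂, ω₁])) := by
  have hω₁ : ω₁ ≠ 0 := by rintro rfl; simp at h₁
  have hω₂ : ω₂ ≠ 0 := by rintro rfl; simp at h₂
  have hp := im_pos_three (im_two_mul_pos h₂) (im_two_mul_pos h₂) h₁
  obtain ⟨a₁, m₁, l₁⟩ := invGamma_comp_line
    (c := fun w => (z + (d + 2 * ω₂), ![2 * ω₂, 2 * ω₂, w])) (x := ω₁) (v := (0, ![0, 0, 1]))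
    (fun w => Prod.ext (by simp) (funext fun i => by fin_cases i <;> simp)) hp n₁
  -- After reflection w enters both the argument and the last period, so the direction is (1, ![0,
  -- 0, 1]).
  obtain ⟨a₂, m₂, l₂⟩ := invGamma_comp_line
    (c := fun w => (-z + (w + (2 * ω₂ - d)), ![2 * ω₂, 2 * ω₂, w])) (x := ω₁) (v := (1, ![0, 0, 1]))
    (fun w => Prod.ext (by simp; ring) (funext fun i => by fin_cases i <;> simp)) hp n₂
  have hP : HasDerivAt (fun w => π * Complex.I / 6 * (1 / (4 * ω₂ ^ 2) *
      ((z + d) ^ 3 * w⁻¹ - 3 / 2 * (z + d) ^ 2 + w * ((z + d) / 2)) - (z + d) / 2 * w⁻¹ + 1 / 4))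
      (π * Complex.I / 6 * (1 / (4 * ω₂ ^ 2) * ((z + d) ^ 3 * -(ω₁ ^ 2)⁻¹ +
        1 * ((z + d) / 2)) - (z + d) / 2 * -(ω₁ ^ 2)⁻¹)) ω₁ :=
    (((((hasDerivAt_inv hω₁).const_mul _).sub_const _ |>.add
      ((hasDerivAt_id ω₁).mul_const _)).const_mul _).sub ((hasDerivAt_inv hω₁).const_mul _)
      |>.add_const (1 / 4)).const_mul _
  have hf : (fun w => G₃ (z + d) (2 * ω₂) w) =ᶠ[𝓝 ω₁] fun w => Complex.exp (π * Complex.I / 6 * (1 / (4 * ω₂ ^ 2) *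
      ((z + d) ^ 3 * w⁻¹ - 3 / 2 * (z + d) ^ 2 + w * ((z + d) / 2)) - (z + d) / 2 * w⁻¹ + 1 / 4)) *
      (invGamma (z + (d + 2 * ω₂), ![2 * ω₂, 2 * ω₂, w]) *
        invGamma (-z + (w + (2 * ω₂ - d)), ![2 * ω₂, 2 * ω₂, w])) := by
    filter_upwards [isOpen_ne.mem_nhds hω₁] with w hw
    rw [G₃_eq, multipleBernoulli_three_three_double hω₂ hw,
      show z + d + 2 * ω₂ = z + (d + 2 * ω₂) by ring,
      show 2 * ω₂ + w - (z + d) = -z + (w + (2 * ω₂ - d)) by ring]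
  have hPa : AnalyticAt ℂ (fun w => π * Complex.I / 6 * (1 / (4 * ω₂ ^ 2) *
      ((z + d) ^ 3 * w⁻¹ - 3 / 2 * (z + d) ^ 2 + w * ((z + d) / 2)) - (z + d) / 2 * w⁻¹ + 1 / 4)) ω₁ := by
    have : AnalyticAt ℂ (fun w : ℂ => w⁻¹) ω₁ := analyticAt_inv hω₁
    fun_prop
  obtain ⟨h3, h4, h5⟩ := logDeriv_exp_mul_mul hf hPa hP a₁
    a₂ m₁ m₂
  refine ⟨h4, ?_⟩
  rw [h5, l₁, l₂]
  congr 2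
  ring

end MainIdentities

end MultipleSine

/-! ### Assembly of the two identities -/

/-- Each `∂ log f` is the logarithmic derivative `f'/f` (independent of the local branch of
`log f`); the functions involved are shown to be holomorphic and non-zero at the point in question,
so that `log f` makes sense there. -/
theorem mainTheorem4 (z ω₁ ω₂ : ℂ) (h₁ : 0 < ω₁.im) (h₂ : 0 < ω₂.im)
    (hz : ∀ a b : ℤ, (a ≤ 0 ∧ b ≤ 0) ∨ (0 < a ∧ 0 < b) →
      z + ω₂ ≠ (a : ℂ) * ω₁ + (b : ℂ) * (2 * ω₂)) :
    -- the four values are non-zero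
    (MultipleSine.F₂ (z + ω₂) ω₁ (2 * ω₂) ≠ 0 ∧
      MultipleSine.G₃ (z + ω₂) ω₁ (2 * ω₂) ≠ 0 ∧
      MultipleSine.G₃ (z + ω₂) (2 * ω₂) ω₁ ≠ 0 ∧
      MultipleSine.G₃ (z - ω₂) (2 * ω₂) ω₁ ≠ 0) ∧
    -- holomorphy in the variables in which they are differentiated
    (AnalyticAt ℂ (fun w => MultipleSine.F₂ (z + w) ω₁ (2 * w)) ω₂ ∧
      AnalyticAt ℂ (fun w => MultipleSine.G₃ (z + w) ω₁ (2 * w)) ω₂ ∧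
      AnalyticAt ℂ (fun w => MultipleSine.G₃ (w + ω₂) (2 * ω₂) ω₁) z ∧
      AnalyticAt ℂ (fun w => MultipleSine.G₃ (w - ω₂) (2 * ω₂) ω₁) z ∧
      AnalyticAt ℂ (fun w => MultipleSine.G₃ (z + ω₂) (2 * ω₂) w) ω₁ ∧
      AnalyticAt ℂ (fun w => MultipleSine.G₃ (z - ω₂) (2 * ω₂) w) ω₁) ∧
    -- the first identity
    logDeriv (fun w => MultipleSine.F₂ (z + w) ω₁ (2 * w)) ω₂ =
      logDeriv (fun w => MultipleSine.G₃ (w + ω₂) (2 * ω₂) ω₁) z +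
        logDeriv (fun w => MultipleSine.G₃ (w - ω₂) (2 * ω₂) ω₁) z ∧
    -- the second identity
    logDeriv (fun w => MultipleSine.G₃ (z + w) ω₁ (2 * w)) ω₂ =
      logDeriv (fun w => MultipleSine.G₃ (z + ω₂) (2 * ω₂) w) ω₁ +
        logDeriv (fun w => MultipleSine.G₃ (z - ω₂) (2 * ω₂) w) ω₁ := by
  have hω₁ : ω₁ ≠ 0 := by rintro rfl; simp at h₁
  have hω₂ : ω₂ ≠ 0 := by rintro rfl; simp at h₂
  have h₂' := MultipleSine.im_two_mul_pos h₂
  have p2 := MultipleSine.im_pos_two h₁ h₂'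
  have p3 := MultipleSine.im_pos_three h₁ h₁ h₂'
  have p3' := MultipleSine.im_pos_three h₂' h₂' h₁
  -- A zero of any of the eight gamma factors would put z + ω₂ on the excluded set: unreflected
  -- factors give a, b ≤ 0, reflected ones a, b > 0.
  have n₁ : MultipleSine.invGamma (z + ω₂, ![ω₁, 2 * ω₂]) ≠ 0 := by
    rw [Ne, MultipleSine.invGamma_eq_zero_iff]
    rintro ⟨n, hn⟩
    refine hz (-n 0) (-n 1) (Or.inl (by omega)) ?_
    simp only [MultipleSine.dot, Fin.sum_univ_two, Matrix.cons_val] at hn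
    push_cast
    linear_combination hn
  have n₂ : MultipleSine.invGamma (-z + (ω₁ + ω₂), ![ω₁, 2 * ω₂]) ≠ 0 := by
    rw [Ne, MultipleSine.invGamma_eq_zero_iff]
    rintro ⟨n, hn⟩
    refine hz (n 0 + 1) (n 1 + 1) (Or.inr (by omega)) ?_
    simp only [MultipleSine.dot, Fin.sum_univ_two, Matrix.cons_val] at hn
    push_cast
    linear_combination -hn
  have n₃ : MultipleSine.invGamma (z + (ω₁ + ω₂), ![ω₁, ω₁, 2 * ω₂]) ≠ 0 := by
    rw [Ne, MultipleSine.invGamma_eq_zero_iff]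
    rintro ⟨n, hn⟩
    refine hz (-(n 0 + n 1 + 1)) (-n 2) (Or.inl (by omega)) ?_
    simp only [MultipleSine.dot, Fin.sum_univ_three, Matrix.cons_val] at hn
    push_cast
    linear_combination hn
  have n₄ : MultipleSine.invGamma (-z + (ω₁ + ω₂), ![ω₁, ω₁, 2 * ω₂]) ≠ 0 := by
    rw [Ne, MultipleSine.invGamma_eq_zero_iff]
    rintro ⟨n, hn⟩
    refine hz (n 0 + n 1 + 1) (n 2 + 1) (Or.inr (by omega)) ?_
    simp only [MultipleSine.dot, Fin.sum_univ_three, Matrix.cons_val] at hn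
    push_cast
    linear_combination -hn
  have m₁ : MultipleSine.invGamma (z + 3 * ω₂, ![2 * ω₂, 2 * ω₂, ω₁]) ≠ 0 := by
    rw [Ne, MultipleSine.invGamma_eq_zero_iff]
    rintro ⟨n, hn⟩
    refine hz (-n 2) (-(n 0 + n 1 + 1)) (Or.inl (by omega)) ?_
    simp only [MultipleSine.dot, Fin.sum_univ_three, Matrix.cons_val] at hn
    push_cast
    linear_combination hn
  have m₂ : MultipleSine.invGamma (z + ω₂, ![2 * ω₂, 2 * ω₂, ω₁]) ≠ 0 := by
    rw [Ne, MultipleSine.invGamma_eq_zero_iff]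
    rintro ⟨n, hn⟩
    refine hz (-n 2) (-(n 0 + n 1)) (Or.inl (by omega)) ?_
    simp only [MultipleSine.dot, Fin.sum_univ_three, Matrix.cons_val] at hn
    push_cast
    linear_combination hn
  have m₃ : MultipleSine.invGamma (-z + (ω₁ + ω₂), ![2 * ω₂, 2 * ω₂, ω₁]) ≠ 0 := by
    rw [Ne, MultipleSine.invGamma_eq_zero_iff]
    rintro ⟨n, hn⟩
    refine hz (n 2 + 1) (n 0 + n 1 + 1) (Or.inr (by omega)) ?_
    simp only [MultipleSine.dot, Fin.sum_univ_three, Matrix.cons_val] at hn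
    push_cast
    linear_combination -hn
  have m₄ : MultipleSine.invGamma (-z + (ω₁ + 3 * ω₂), ![2 * ω₂, 2 * ω₂, ω₁]) ≠ 0 := by
    rw [Ne, MultipleSine.invGamma_eq_zero_iff]
    rintro ⟨n, hn⟩
    -- Here z = ω₁ + 3ω₂ + …, and adding ω₂ makes 4ω₂, that is two periods 2ω₂.
    refine hz (n 2 + 1) (n 0 + n 1 + 2) (Or.inr (by omega)) ?_
    simp only [MultipleSine.dot, Fin.sum_univ_three, Matrix.cons_val] at hn
    push_cast
    linear_combination -hn
  have e₁ : ω₂ + 2 * ω₂ = 3 * ω₂ := by ring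
  have e₂ : 2 * ω₂ - ω₂ = ω₂ := by ring
  have e₃ : -ω₂ + 2 * ω₂ = ω₂ := by ring
  have e₄ : 2 * ω₂ - -ω₂ = 3 * ω₂ := by ring
  obtain ⟨F0, Fa, Fl⟩ := MultipleSine.logDeriv_F₂ h₁ h₂ n₁ n₂
  obtain ⟨G0, Ga, Gl⟩ := MultipleSine.logDeriv_G₃_left h₁ h₂ n₃ n₄
  obtain ⟨A0, Aa, Al⟩ := MultipleSine.logDeriv_G₃_fst (z := z) h₁ h₂ ω₂ (by rwa [e₁])
    (by rwa [e₂])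
  obtain ⟨B0, Ba, Bl⟩ := MultipleSine.logDeriv_G₃_fst (z := z) h₁ h₂ (-ω₂) (by rwa [e₃])
    (by rwa [e₄])
  obtain ⟨Ca, Cl⟩ := MultipleSine.logDeriv_G₃_snd (z := z) h₁ h₂ ω₂ (by rwa [e₁]) (by rwa [e₂])
  obtain ⟨Da, Dl⟩ := MultipleSine.logDeriv_G₃_snd (z := z) h₁ h₂ (-ω₂) (by rwa [e₃]) (by rwa [e₄])
  rw [e₁, e₂] at Al Cl
  rw [e₃, e₄] at Bl Dl
  have r₁ := MultipleSine.fderiv_invGamma_div_eq_add p2 p3' p3'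
    (fun x _ => MultipleSine.fderiv_kernel_two_relation h₁ h₂ x) n₁ m₁ m₂
  -- For the reflected factors of F₂ the first relation is shifted by ω₁ and evaluated at -z.
  have r₂ := MultipleSine.fderiv_invGamma_div_eq_add p2 p3' p3' (v₀ := (1, ![0, 2]))
    (v₁ := (1, 0)) (v₂ := (1, 0)) (fun x _ ht => by
      simpa only [add_assoc] using
        MultipleSine.fderiv_kernel_two_relation h₁ h₂ (x + ω₁) ht) n₂ m₄ m₃
  have r₃ := MultipleSine.fderiv_invGamma_div_eq_add p3 p3' p3'
    (fun x _ => MultipleSine.fderiv_kernel_three_relation h₁ h₂ x) n₃ m₁ m₂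
  have r₄ := MultipleSine.fderiv_invGamma_div_eq_add p3 p3' p3'
    (fun x _ => MultipleSine.fderiv_kernel_three_reflected_relation h₁ h₂ x) n₄ m₃ m₄
  -- Puts z - ω₂ in the form z + d with d = -ω₂.
  simp only [sub_eq_add_neg z, fun w : ℂ => sub_eq_add_neg w ω₂]
  refine ⟨⟨F0, G0, A0, B0⟩, ⟨Fa, Ga, Aa, Ba, Ca, Da⟩, ?_, ?_⟩
  · rw [Fl, Al, Bl, r₁, r₂]
    -- The gamma factors now match; what remains is the contribution of the Bernoulli exponentials.
    have : -(Real.pi * Complex.I / 2) *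
        (-(z ^ 2 / (2 * ω₁) - z / 2 + ω₁ / 12) / ω₂ ^ 2 - 1 / (6 * ω₁)) =
        Real.pi * Complex.I / 6 * (1 / (4 * ω₂ ^ 2) *
          (3 * (z + ω₂) ^ 2 * ω₁⁻¹ - 3 * (z + ω₂) + ω₁ / 2) - 1 / 2 * ω₁⁻¹) +
        Real.pi * Complex.I / 6 * (1 / (4 * ω₂ ^ 2) *
          (3 * (z + -ω₂) ^ 2 * ω₁⁻¹ - 3 * (z + -ω₂) + ω₁ / 2) - 1 / 2 * ω₁⁻¹) := by
      field_simp
      ring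
    linear_combination this
  · rw [Gl, Cl, Dl, r₃, r₄]
    have : Real.pi * Complex.I / 6 *
        (-(z ^ 3 / (2 * ω₁ ^ 2) - z / 4) / ω₂ ^ 2 - z / (2 * ω₁ ^ 2)) =
        Real.pi * Complex.I / 6 * (1 / (4 * ω₂ ^ 2) *
          (-(z + ω₂) ^ 3 / ω₁ ^ 2 + (z + ω₂) / 2) + (z + ω₂) / 2 / ω₁ ^ 2) +
        Real.pi * Complex.I / 6 * (1 / (4 * ω₂ ^ 2) *
          (-(z + -ω₂) ^ 3 / ω₁ ^ 2 + (z + -ω₂) / 2) + (z + -ω₂) / 2 / ω₁ ^ 2) := by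
      field_simp
      ring
    linear_combination this
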